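/- Let $n,m\in\mathbb R$, $\mathcal B>0$ and $q:=m-n+1$. Let $h_{\rm ss}\in C^4(\mathbb R)$ be a non-constant, positive, periodic steady state, with least period $X>0$, of the equation $$h_t=-(h^n h_{xxx})_x-\mathcal B\,(h^m h_x)_x .$$ Let $H$ be any function with $H''(y)=\mathcal B y^{q-1}$ for $y>0$, let $\mathcal E(\ell):=\int_0^X\left[\tfrac12(\ell')^2-H(\ell)\right]dx$ be the energy of a positive $X$-periodic function $\ell$, and let $\overline{h_{\rm ss}}:=\frac1X\int_0^X h_{\rm ss}\,dx$, regarded as a constant function. For $\alpha\in(0,1)$ let $k_\alpha$ be the unique smooth positive periodic solution of $k''+\frac{k^q-1}{q}=0$ (of $k''+\log k=0$ if $q=0$) with $k(0)=\alpha$, $k'(0)=0$; let $P(\alpha)$ be its least period, $A(\alpha):=\int_0^{P(\alpha)}k_\alpha\,dx$, and $E(\alpha):=P(\alpha)^{3-q}A(\alpha)^{q-1}$. 1. If $q\ge 2$ or $q<1$, then $\mathcal E(h_{\rm ss})>\mathcal E(\overline{h_{\rm ss}})$. 2. If $q=1$, then $\mathcal E(h_{\rm ss})=\mathcal E(\overline{h_{\rm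 ss}})$. 3. Translate $h_{\rm ss}$ so that its minimum is at $x=0$. Then $h_{\rm ss}$ rescales to $k_\alpha$ for some $\alpha\in(0,1)$, in the following sense. If $q\ne0$, there is a constant $D>0$ with $h_{\rm ss}''+\frac{\mathcal B h_{\rm ss}^q-D}{q}=0$ and $$k_\alpha(x)=\left(\tfrac{\mathcal B}{D}\right)^{1/q}h_{\rm ss}\!\left(\left(\tfrac{D}{\mathcal B}\right)^{1/(2q)}\tfrac{x}{D^{1/2}}\right)\quad\text{for all }x;$$ if $q=0$, there is a constant $D\in\mathbb R$ with $h_{\rm ss}''+\mathcal B\log h_{\rm ss}-D=0$ and $$k_\alpha(x)=e^{-D/\mathcal B}\,h_{\rm ss}\!\left(e^{D/(2\mathcal B)}\tfrac{x}{\mathcal B^{1/2}}\right)\quad\text{for all }x.$$ For every such $\alpha$: (a) if $1<q<2$ and $E'>0$ on $(\alpha,1)$, then $\mathcal E(h_{\rm ss})>\mathcal E(\overline{h_{\rm ss}})$; (b) if $1<q<2$ and $E'<0$ on $(\alpha,1)$, then $\mathcal E(h_{\rm ss})<\mathcal E(\overline{h_{\rm ss}})$. -/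

import Mathlib

/-- `H'' = g / f` on `(0, ∞)`. -/
def IsEnergyPotential (f g H : ℝ → ℝ) : Prop :=
  ∀ y, 0 < y → DifferentiableAt ℝ H y ∧ HasDerivAt (deriv H) (g y / f y) y

/-- The energy `∫_0^X [ (ℓ')² / 2 - H(ℓ) ] dx` of an `X`-periodic function `ℓ`. -/
noncomputable def filmEnergy (H : ℝ → ℝ) (X : ℝ) (l : ℝ → ℝ) : ℝ :=
  ∫ x in (0 : ℝ)..X, (1 / 2 * (deriv l x) ^ 2 - H (l x))

/-- The mean value of `l` over `[0, X]`. -/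
noncomputable def meanOver (X : ℝ) (l : ℝ → ℝ) : ℝ :=
  1 / X * ∫ x in (0 : ℝ)..X, l x

/-- The positive periods of a function. -/
def positivePeriods (h : ℝ → ℝ) : Set ℝ :=
  {T | 0 < T ∧ Function.Periodic h T}

/-- `h` is a classical time-independent solution of `h_t = -(f(h) h_xxx)_x - (g(h) h_x)_x` that is
`C⁴`, positive, non-constant, and periodic with least period `X`. -/
structure IsPositivePeriodicSteadyState (f g : ℝ → ℝ) (X : ℝ) (h : ℝ → ℝ) : Prop where
  contDiff : ContDiff ℝ 4 h
  pos : ∀ x, 0 < h x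
  nonconstant : ∃ x y, h x ≠ h y
  leastPeriod : IsLeast (positivePeriods h) X
  steady : ∀ x, -(deriv (fun z => f (h z) * iteratedDeriv 3 h z) x)
      - deriv (fun z => g (h z) * deriv h z) x = 0

/-- The restoring force of the canonical oscillator: `(y^q - 1)/q`, or `log y` when `q = 0`. -/
noncomputable def oscForce (q y : ℝ) : ℝ :=
  if q = 0 then Real.log y else (y ^ q - 1) / q

/-- `k` is a smooth positive periodic solution of `k'' + (k^q - 1)/q = 0` (`k'' + log k = 0` when
`q = 0`) with `k(0) = α`, `k'(0) = 0`. -/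
structure IsCanonicalSolution (q α : ℝ) (k : ℝ → ℝ) : Prop where
  smooth : ContDiff ℝ (⊤ : ℕ∞) k
  pos : ∀ x, 0 < k x
  periodic : (positivePeriods k).Nonempty
  ode : ∀ x, deriv (deriv k) x + oscForce q (k x) = 0
  init : k 0 = α
  init_deriv : deriv k 0 = 0

/-- The canonical solution `k_α` (for `0 < α < 1` there is exactly one). -/
noncomputable def kCanon (q α : ℝ) : ℝ → ℝ :=
  Classical.epsilon (IsCanonicalSolution q α)

/-- `P(α)`, the least period of `k_α`. -/
noncomputable def periodMap (q α : ℝ) : ℝ :=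
  sInf (positivePeriods (kCanon q α))

/-- `A(α) = ∫_0^{P(α)} k_α dx`. -/
noncomputable def areaMap (q α : ℝ) : ℝ :=
  ∫ x in (0 : ℝ)..(periodMap q α), kCanon q α x

/-- `E(α) = P(α)^{3-q} A(α)^{q-1}`. -/
noncomputable def bifE (q α : ℝ) : ℝ :=
  periodMap q α ^ (3 - q) * areaMap q α ^ (q - 1)

/-- `k` is the rescaling of the steady state `h`, where `D` is the integration constant in
`h'' + (B h^q - D)/q = 0` (in `h'' + B log h - D = 0` when `q = 0`). -/
def RescalesTo (q B : ℝ) (h k : ℝ → ℝ) : Prop :=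
  (q ≠ 0 ∧ ∃ D : ℝ, 0 < D ∧
    (∀ x, deriv (deriv h) x + (B * h x ^ q - D) / q = 0) ∧
    ∀ x, k x = (B / D) ^ (1 / q) * h ((D / B) ^ (1 / (2 * q)) * (x / D ^ (1 / 2 : ℝ)))) ∨
  (q = 0 ∧ ∃ D : ℝ,
    (∀ x, deriv (deriv h) x + B * Real.log (h x) - D = 0) ∧
    ∀ x, k x = Real.exp (-D / B) * h (Real.exp (D / (2 * B)) * (x / B ^ (1 / 2 : ℝ))))

open Set Filter Topology MeasureTheory

/-! Integrating the steady state equation once gives a constant flux, and periodicity forces it to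
vanish. A second integration gives an oscillator `h'' + F(h) = 0` with `F' = Q` and `Q y = B
y^(q-1)`. The primitive `V` of `F` differs from `H` by an affine function, so with `m` the mean of
`h` the energy excess over the mean is `∫ (h'²/2 - (V(h) - V(m)))`.

If `q ≥ 2` or `q < 1`, then `Q` is convex and strictly monotone. The pointwise bound
`potential_sub_le` and the identity `∫ F(h)(h - m) = ∫ h'²` show that the excess is at least `(∫ h'²
- Q(m) ∫ (h - m)²) / 6`. Wirtinger's inequality reduces positivity to `Q(m) < (2π/X)²`, which is
`stiffness_mean_lt`. There `h` is split into its even and odd parts about the quarter period, the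
odd part is tested against a cosine, and convexity and a Chebyshev inequality give the sign. If `q =
1`, `F` is affine, the trapezoidal rule for `V` is exact, and the excess is zero.

For `1 < q < 2` the excess is a positive multiple of a scale-invariant quantity `canonGap` of the
canonical solution. Rescaled to unit period and unit area, `k_α` becomes a solution `u` of `u'' + (E
u^q - const)/q = 0`, a critical point at fixed mean of an energy that depends on `α` only through
`E(α)`. The derivative of the gap along the family is therefore its partial derivative in `E` times
`E'`, namely `-(∫ u^(q+1) - 1) E' / (q(q+1))` (`hasDerivAt_canonGap`), and `∫ u^(q+1) > 1` by
Jensen. The gap vanishes at `α = 1`, so the sign of `E'` on `(α, 1)` decides its sign at `α`.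
Regularity up to `α = 1` comes from a coordinate in which the potential is `t²/2`: orbits become
circles, and period and action become integrals over a fixed interval. -/

/-- `h` is a positive solution, with velocity `p`, of the oscillator equation `h'' + F h = 0`. -/
structure IsOscillation (F h p : ℝ → ℝ) : Prop where
  pos : ∀ x, 0 < h x
  hasDerivAt : ∀ x, HasDerivAt h (p x) x
  hasDerivAt_vel : ∀ x, HasDerivAt p (-F (h x)) x

/-! ### Uniqueness, symmetry and energy conservation for periodic oscillations -/

/-- A continuous positive periodic function takes values in a compact subset of `(0, ∞)`. -/
theorem exists_Icc_of_continuous_periodic {h : ℝ → ℝ} {X : ℝ} (hX : 0 < X)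
    (hc : Continuous h) (hp : Function.Periodic h X) (hpos : ∀ x, 0 < h x) :
    ∃ a b, 0 < a ∧ ∀ x, h x ∈ Icc a b := by
  obtain ⟨x₀, -, hx₀⟩ := isCompact_Icc.exists_isMinOn (nonempty_Icc.2 hX.le) hc.continuousOn
  obtain ⟨x₁, -, hx₁⟩ := isCompact_Icc.exists_isMaxOn (nonempty_Icc.2 hX.le) hc.continuousOn
  refine ⟨h x₀, h x₁, hpos _, fun x => ?_⟩
  obtain ⟨y, hy, hxy⟩ := hp.exists_mem_Ico₀ hX x
  rw [hxy]
  exact ⟨hx₀ (Ico_subset_Icc_self hy), hx₁ (Ico_subset_Icc_self hy)⟩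

theorem exists_min_of_continuous_periodic {h : ℝ → ℝ} {X : ℝ} (hX : 0 < X)
    (hc : Continuous h) (hp : Function.Periodic h X) : ∃ x₀, ∀ x, h x₀ ≤ h x := by
  obtain ⟨x₀, -, hx₀⟩ := isCompact_Icc.exists_isMinOn (nonempty_Icc.2 hX.le) hc.continuousOn
  refine ⟨x₀, fun x => ?_⟩
  obtain ⟨y, hy, hxy⟩ := hp.exists_mem_Ico₀ hX x
  rw [hxy]
  exact hx₀ (Ico_subset_Icc_self hy)

namespace IsOscillation

variable {F Q h p h₁ p₁ : ℝ → ℝ}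

theorem continuous (ho : IsOscillation F h p) : Continuous h :=
  continuous_iff_continuousAt.2 fun x => (ho.hasDerivAt x).continuousAt

theorem continuous_vel (ho : IsOscillation F h p) : Continuous p :=
  continuous_iff_continuousAt.2 fun x => (ho.hasDerivAt_vel x).continuousAt

theorem continuous_comp (ho : IsOscillation F h p) {G : ℝ → ℝ} (hG : ContinuousOn G (Ioi 0)) :
    Continuous fun x => G (h x) :=
  hG.comp_continuous ho.continuous ho.pos

/-- Two oscillations confined to the same compact set and with the same data at one point agree. -/
theorem eq_of_init (hF : ∀ y, 0 < y → HasDerivAt F (Q y) y) (hQ : ContinuousOn Q (Ioi 0))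
    (ho : IsOscillation F h p) (ho₁ : IsOscillation F h₁ p₁) {a b : ℝ} (ha : 0 < a)
    (hab : ∀ x, h x ∈ Icc a b) (hab₁ : ∀ x, h₁ x ∈ Icc a b) {x₀ : ℝ}
    (h0 : h x₀ = h₁ x₀) (hp0 : p x₀ = p₁ x₀) : h = h₁ := by
  have hsub : Icc a b ⊆ Ioi 0 := fun y hy => ha.trans_le hy.1
  obtain ⟨C, hC⟩ := isCompact_Icc.exists_bound_of_continuousOn (hQ.mono hsub)
  -- The force may be singular at `0`. On an interval `[a, b]` with `a > 0` a bound on `Q` gives a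
  -- Lipschitz constant, hence the confinement of both oscillations to one compact set.
  have hlip : LipschitzOnWith (Real.toNNReal C) F (Icc a b) := by
    refine (convex_Icc a b).lipschitzOnWith_of_nnnorm_hasDerivWithin_le (f' := Q)
      (fun y hy => (hF y (hsub hy)).hasDerivWithinAt) fun y hy => ?_
    rw [← NNReal.coe_le_coe, coe_nnnorm]
    exact (hC y hy).trans (Real.le_coe_toNNReal C)
  have hv : LipschitzOnWith (max 1 (Real.toNNReal C)) (fun z : ℝ × ℝ => (z.2, -F z.1))
      (Icc a b ×ˢ univ) := by
    refine LipschitzOnWith.prodMk (LipschitzWith.prod_snd.lipschitzOnWith) ?_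
    have := (hlip.comp (LipschitzWith.prod_fst (α := ℝ) (β := ℝ)).lipschitzOnWith
      (s := Icc a b ×ˢ univ) fun z hz => hz.1).neg
    simpa only [mul_one] using! this
  have := ODE_solution_unique_univ (v := fun _ z => (z.2, -F z.1)) (s := fun _ => Icc a b ×ˢ univ)
    (f := fun x => (h x, p x)) (g := fun x => (h₁ x, p₁ x)) (t₀ := x₀) (fun _ => hv)
    (fun x => ⟨(ho.hasDerivAt x).prodMk (ho.hasDerivAt_vel x), hab x, mem_univ _⟩)
    (fun x => ⟨(ho₁.hasDerivAt x).prodMk (ho₁.hasDerivAt_vel x), hab₁ x, mem_univ _⟩)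
    (Prod.ext h0 hp0)
  exact funext fun x => congrArg Prod.fst (congrFun this x)

theorem reflect (ho : IsOscillation F h p) (c : ℝ) :
    IsOscillation F (fun x => h (c - x)) fun x => -p (c - x) where
  pos _ := ho.pos _
  hasDerivAt x := by
    exact (ho.hasDerivAt (c - x)).comp_const_sub c x
  hasDerivAt_vel x := by
    simpa using ((ho.hasDerivAt_vel (c - x)).comp_const_sub c x).fun_neg

theorem shift (ho : IsOscillation F h p) (c : ℝ) :
    IsOscillation F (fun x => h (x + c)) fun x => p (x + c) where
  pos _ := ho.pos _
  hasDerivAt x := (ho.hasDerivAt (x + c)).comp_add_const x c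
  hasDerivAt_vel x := (ho.hasDerivAt_vel (x + c)).comp_add_const x c

/-- A periodic oscillation is symmetric about each of its critical points. -/
theorem symm_of_vel_eq_zero (hF : ∀ y, 0 < y → HasDerivAt F (Q y) y)
    (hQ : ContinuousOn Q (Ioi 0)) (ho : IsOscillation F h p) {X : ℝ} (hX : 0 < X)
    (hper : Function.Periodic h X) {c : ℝ} (hc : p c = 0) (x : ℝ) : h (2 * c - x) = h x := by
  obtain ⟨a, b, ha, hab⟩ := exists_Icc_of_continuous_periodic hX ho.continuous hper ho.pos
  refine congrFun (eq_of_init (x₀ := c) hF hQ (ho.reflect (2 * c)) ho ha (fun x => hab _) hab ?_ ?_)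
    x
  · congr 1; ring
  · rw [show 2 * c - c = c by ring, hc, neg_zero]

/-- An oscillation with a minimum at `0` increases during the first half of its least period. -/
theorem vel_pos (hF : ∀ y, 0 < y → HasDerivAt F (Q y) y)
    (hQ : ContinuousOn Q (Ioi 0)) (ho : IsOscillation F h p) {X : ℝ}
    (hX : IsLeast (positivePeriods h) X) (hmin : ∀ x, h 0 ≤ h x) {x : ℝ} (hx : x ∈ Ioo 0 (X / 2)) :
    0 < p x := by
  have hp0 : p 0 = 0 := IsLocalMin.hasDerivAt_eq_zero (Eventually.of_forall hmin) (ho.hasDerivAt 0)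
  have hne : ∀ y ∈ Ioo 0 (X / 2), p y ≠ 0 := by
    intro y hy hpy
    have h1 := symm_of_vel_eq_zero hF hQ ho hX.1.1 hX.1.2 hp0
    have h2 := symm_of_vel_eq_zero hF hQ ho hX.1.1 hX.1.2 hpy
    -- The reflections in `0` and in `y` compose to the translation by `2 * y`, which would be a
    -- period below `X`.
    have : X ≤ 2 * y := hX.2 ⟨by linarith [hy.1], fun z => by
      rw [← h1 z, ← h2]; congr 1; ring⟩
    linarith [hy.2]
  by_contra hcon
  have hneg : p x < 0 := lt_of_le_of_ne (not_lt.1 hcon) (hne x hx)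
  have hall : ∀ y ∈ Ioo 0 x, p y < 0 := by
    intro y hy
    by_contra hcy
    have hy0 : 0 ≤ p y := not_lt.1 hcy
    obtain ⟨z, hz, hz0⟩ := intermediate_value_Icc' hy.2.le ho.continuous_vel.continuousOn
      (show (0 : ℝ) ∈ Icc (p x) (p y) from ⟨hneg.le, hy0⟩)
    exact hne z ⟨hy.1.trans_le hz.1, hz.2.trans_lt hx.2⟩ hz0
  have : StrictAntiOn h (Icc 0 x) := by
    refine strictAntiOn_of_deriv_neg (convex_Icc 0 x) ho.continuous.continuousOn fun y hy => ?_
    rw [interior_Icc] at hy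
    rw [(ho.hasDerivAt y).deriv]
    exact hall y hy
  exact absurd (hmin x) (not_le.2 (this (left_mem_Icc.2 hx.1.le) (right_mem_Icc.2 hx.1.le) hx.1))

/-- Conservation of energy. -/
theorem energy_eq {V : ℝ → ℝ} (hV : ∀ y, 0 < y → HasDerivAt V (F y) y)
    (ho : IsOscillation F h p) (x y : ℝ) :
    1 / 2 * p x ^ 2 + V (h x) = 1 / 2 * p y ^ 2 + V (h y) := by
  have hd : ∀ z, HasDerivAt (fun z => 1 / 2 * p z ^ 2 + V (h z)) 0 z := fun z => by
    have h1 := ((ho.hasDerivAt_vel z).pow 2).const_mul (1 / 2)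
    have h2 := (hV _ (ho.pos z)).comp z (ho.hasDerivAt z)
    convert! h1.add h2 using 1
    simp; ring
  exact is_const_of_deriv_eq_zero (fun z => (hd z).differentiableAt) (fun z => (hd z).deriv) x y

end IsOscillation

/-! ### Quadrature inequalities for convex stiffness -/

/-- The trapezoidal rule overestimates the integral of a convex function. -/
theorem monotoneOn_trapezoid_sub {F Q Q' : ℝ → ℝ} (hF : ∀ y, 0 < y → HasDerivAt F (Q y) y)
    (hQ : ∀ y, 0 < y → HasDerivAt Q (Q' y) y)
    (hconv : ∀ y, 0 < y → ∀ z, 0 < z → Q y + Q' y * (z - y) ≤ Q z) {m : ℝ} (hm : 0 < m) :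
    MonotoneOn (fun y => (Q y + Q m) * (y - m) - 2 * (F y - F m)) (Ioi 0) := by
  have hd : ∀ y, 0 < y → HasDerivAt (fun y => (Q y + Q m) * (y - m) - 2 * (F y - F m))
      (Q' y * (y - m) + (Q y + Q m) * 1 - 2 * Q y) y := fun y hy =>
    (((hQ y hy).add_const _).mul ((hasDerivAt_id y).sub_const m)).sub
      (((hF y hy).sub_const _).const_mul 2)
  refine monotoneOn_of_deriv_nonneg (convex_Ioi 0)
    (fun y hy => (hd y hy).continuousAt.continuousWithinAt)
    (fun y hy => ((hd y (interior_subset hy)).differentiableAt).differentiableWithinAt)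
    fun y hy => ?_
  rw [interior_Ioi] at hy
  rw [(hd y hy).deriv]
  -- The derivative equals `Q m - Q y - Q' y * (m - y)`, the height of `Q` at `m` above its tangent
  -- at `y`.
  nlinarith [hconv y hy m hm]

/-- A third-order Hermite-type bound for a potential whose second derivative is convex. -/
theorem potential_sub_le {V F Q Q' : ℝ → ℝ} (hV : ∀ y, 0 < y → HasDerivAt V (F y) y)
    (hF : ∀ y, 0 < y → HasDerivAt F (Q y) y) (hQ : ∀ y, 0 < y → HasDerivAt Q (Q' y) y)
    (hconv : ∀ y, 0 < y → ∀ z, 0 < z → Q y + Q' y * (z - y) ≤ Q z) {m y : ℝ}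
    (hm : 0 < m) (hy : 0 < y) :
    V y - V m ≤ 2 / 3 * (F m * (y - m)) + 1 / 3 * (F y * (y - m)) + 1 / 6 * (Q m * (y - m) ^ 2) := by
  set ψ : ℝ → ℝ := fun y => 2 / 3 * (F m * (y - m)) + 1 / 3 * (F y * (y - m))
    + 1 / 6 * (Q m * (y - m) ^ 2) - (V y - V m) with hψ
  set χ : ℝ → ℝ := fun y => (Q y + Q m) * (y - m) - 2 * (F y - F m) with hχ
  have hmono : MonotoneOn χ (Ioi 0) := monotoneOn_trapezoid_sub hF hQ hconv hm
  have hχm : χ m = 0 := by simp [hχ]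
  have hψm : ψ m = 0 := by simp [hψ]
  -- The weights `2/3`, `1/3`, `1/6` make `ψ'` a third of the trapezoidal defect `χ`. Since the
  -- weight of `F y` is below `1/2`, part of the kinetic energy survives when the bound is
  -- integrated.
  have hd : ∀ y, 0 < y → HasDerivAt ψ (1 / 3 * χ y) y := fun y hy => by
    have hid := (hasDerivAt_id y).sub_const m
    have := ((((hid.const_mul (F m)).const_mul (2 / 3)).add
      (((hF y hy).mul hid).const_mul (1 / 3))).add
      (((hid.pow 2).const_mul (Q m)).const_mul (1 / 6))).sub ((hV y hy).sub_const (V m))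
    convert! this using 1
    simp [hχ]; ring
  have key : 0 ≤ ψ y := by
    rcases le_total m y with hmy | hmy
    · have : MonotoneOn ψ (Icc m y) := by
        refine monotoneOn_of_deriv_nonneg (convex_Icc m y)
          (fun z hz => (hd z (hm.trans_le hz.1)).continuousAt.continuousWithinAt)
          (fun z hz => ((hd z (hm.trans_le (interior_subset hz).1)).differentiableAt).differentiableWithinAt)
          fun z hz => ?_
        rw [interior_Icc] at hz
        have hz0 : 0 < z := hm.trans hz.1
        rw [(hd z hz0).deriv]
        have := hmono (mem_Ioi.2 hm) (mem_Ioi.2 hz0) hz.1.le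
        rw [hχm] at this
        positivity
      rw [← hψm]
      exact this (left_mem_Icc.2 hmy) (right_mem_Icc.2 hmy) hmy
    · have : AntitoneOn ψ (Icc y m) := by
        refine antitoneOn_of_deriv_nonpos (convex_Icc y m)
          (fun z hz => (hd z (hy.trans_le hz.1)).continuousAt.continuousWithinAt)
          (fun z hz => ((hd z (hy.trans_le (interior_subset hz).1)).differentiableAt).differentiableWithinAt)
          fun z hz => ?_
        rw [interior_Icc] at hz
        have hz0 : 0 < z := hy.trans hz.1
        rw [(hd z hz0).deriv]
        have := hmono (mem_Ioi.2 hz0) (mem_Ioi.2 hm) hz.2.le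
        rw [hχm] at this
        linarith
      rw [← hψm]
      exact this (left_mem_Icc.2 hmy) (right_mem_Icc.2 hmy) hmy
  simp only [hψ] at key
  linarith

/-- At two points of equal potential, the forces cannot balance if the force is strictly convex
(`0 < σ`) or strictly concave (`σ < 0`). -/
theorem force_add_pos_of_potential_eq {V F Q Q' : ℝ → ℝ} {σ : ℝ}
    (hV : ∀ y, 0 < y → HasDerivAt V (F y) y)
    (hF : ∀ y, 0 < y → HasDerivAt F (Q y) y) (hQ : ∀ y, 0 < y → HasDerivAt Q (Q' y) y)
    (hσ : ∀ y, 0 < y → 0 < σ * Q' y) {a b : ℝ} (ha : 0 < a) (hab : a < b) (hVab : V a = V b) :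
    0 < σ * (F a + F b) := by
  -- This is `2 * σ` times the trapezoidal error for `∫ F` over `[a, y]`. At `b` that integral is `V
  -- b - V a = 0`, so only the sum of the forces remains.
  set ψ : ℝ → ℝ := fun y => σ * ((y - a) * (F a + F y) - 2 * (V y - V a)) with hψ
  set χ : ℝ → ℝ := fun y => σ * ((y - a) * Q y - (F y - F a)) with hχ
  have hdχ : ∀ y, 0 < y → HasDerivAt χ (σ * Q' y * (y - a)) y := fun y hy => by
    have hid := (hasDerivAt_id y).sub_const a
    have := ((hid.mul (hQ y hy)).sub ((hF y hy).sub_const (F a))).const_mul σ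
    convert! this using 1
    simp; ring
  have hdψ : ∀ y, 0 < y → HasDerivAt ψ (χ y) y := fun y hy => by
    have hid := (hasDerivAt_id y).sub_const a
    have := ((hid.mul ((hF y hy).const_add (F a))).sub
      (((hV y hy).sub_const (V a)).const_mul 2)).const_mul σ
    convert! this using 1
    simp only [hχ, id]; ring
  have hχpos : ∀ y, a < y → 0 < χ y := by
    intro y hy
    have : StrictMonoOn χ (Icc a y) := by
      refine strictMonoOn_of_deriv_pos (convex_Icc a y)
        (fun z hz => (hdχ z (ha.trans_le hz.1)).continuousAt.continuousWithinAt) fun z hz => ?_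
      rw [interior_Icc] at hz
      rw [(hdχ z (ha.trans hz.1)).deriv]
      exact mul_pos (hσ z (ha.trans hz.1)) (sub_pos.2 hz.1)
    have h2 := this (left_mem_Icc.2 hy.le) (right_mem_Icc.2 hy.le) hy
    simpa [hχ] using h2
  have hmono : StrictMonoOn ψ (Icc a b) := by
    refine strictMonoOn_of_deriv_pos (convex_Icc a b)
      (fun z hz => (hdψ z (ha.trans_le hz.1)).continuousAt.continuousWithinAt) fun z hz => ?_
    rw [interior_Icc] at hz
    rw [(hdψ z (ha.trans hz.1)).deriv]
    exact hχpos z hz.1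
  have h2 := hmono (left_mem_Icc.2 hab.le) (right_mem_Icc.2 hab.le) hab
  have h3 : 0 < σ * ((b - a) * (F a + F b)) := by simpa [hψ, hVab] using h2
  have h4 : 0 < (b - a) * (σ * (F a + F b)) := by linarith
  exact pos_of_mul_pos_right h4 (sub_pos.2 hab).le

/-- The midpoint rule underestimates the integral of a convex function. -/
theorem midpoint_le {F Q Q' : ℝ → ℝ} (hF : ∀ y, 0 < y → HasDerivAt F (Q y) y)
    (hconv : ∀ y, 0 < y → ∀ z, 0 < z → Q y + Q' y * (z - y) ≤ Q z) {s d : ℝ} (hd : 0 ≤ d)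
    (hds : d < s) : 2 * d * Q s ≤ F (s + d) - F (s - d) := by
  have hder : ∀ t ∈ Icc 0 d, HasDerivAt (fun t => F (s + t) - F (s - t) - 2 * t * Q s)
      (Q (s + t) + Q (s - t) - 2 * Q s) t := fun t ht => by
    have h1 := (hF (s + t) (by linarith [ht.1])).comp_const_add s t
    have h2 := (hF (s - t) (by linarith [ht.2])).comp_const_sub s t
    have h3 := ((hasDerivAt_id t).const_mul 2).mul_const (Q s)
    convert! (h1.sub h2).sub h3 using 1
    ring
  have : MonotoneOn (fun t => F (s + t) - F (s - t) - 2 * t * Q s) (Icc 0 d) := by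
    refine monotoneOn_of_deriv_nonneg (convex_Icc 0 d)
      (fun t ht => (hder t ht).continuousAt.continuousWithinAt)
      (fun t ht => ((hder t (interior_subset ht)).differentiableAt).differentiableWithinAt)
      fun t ht => ?_
    have ht' := interior_subset ht
    rw [(hder t ht').deriv]
    have h1 := hconv s (by linarith) (s + t) (by linarith [ht'.1])
    have h2 := hconv s (by linarith) (s - t) (by linarith [ht'.2])
    linarith
  have h := this (left_mem_Icc.2 hd) (right_mem_Icc.2 hd) hd
  simp at h
  linarith

/-! ### Chebyshev and Wirtinger inequalities -/

/-- A strict Chebyshev integral inequality. -/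
theorem integral_mul_pos_of_strictAntiOn {f g : ℝ → ℝ} {L : ℝ} (hL : 0 < L) (hf : Continuous f)
    (hg : Continuous g) (hfa : StrictAntiOn f (Icc 0 L)) (hga : StrictAntiOn g (Icc 0 L))
    (h0 : ∫ x in (0 : ℝ)..L, f x = 0) : 0 < ∫ x in (0 : ℝ)..L, f x * g x := by
  -- Rolle's theorem for the primitive of `f` gives a zero `c` of `f`. Then `f` and `g - g c` change
  -- sign together at `c`, and the constant `g c` does not affect the integral because `f` has mean
  -- zero.
  obtain ⟨c, hc, hfc⟩ := exists_hasDerivAt_eq_zero (f := fun t => ∫ x in (0 : ℝ)..t, f x) (f' := f)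
    hL (intervalIntegral.continuous_primitive (fun a b => hf.intervalIntegrable a b) 0).continuousOn
    (by simp [h0]) (fun x _ => (hf.integral_hasStrictDerivAt 0 x).hasDerivAt)
  have hcI : c ∈ Icc 0 L := Ioo_subset_Icc_self hc
  have hpos : 0 < ∫ x in (0 : ℝ)..L, f x * (g x - g c) := by
    refine intervalIntegral.integral_pos hL (by fun_prop) (fun x hx => ?_) ⟨0, ⟨le_rfl, hL.le⟩, ?_⟩
    · have hxI : x ∈ Icc 0 L := Ioc_subset_Icc_self hx
      rcases le_total x c with hxc | hxc
      · have h1 := hfa.antitoneOn hxI hcI hxc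
        have h2 := hga.antitoneOn hxI hcI hxc
        exact mul_nonneg (hfc ▸ h1) (sub_nonneg.2 h2)
      · have h1 := hfa.antitoneOn hcI hxI hxc
        have h2 := hga.antitoneOn hcI hxI hxc
        exact mul_nonneg_of_nonpos_of_nonpos (hfc ▸ h1) (sub_nonpos.2 h2)
    · have h1 := hfa (left_mem_Icc.2 hL.le) hcI hc.1
      have h2 := hga (left_mem_Icc.2 hL.le) hcI hc.1
      exact mul_pos (hfc ▸ h1) (sub_pos.2 h2)
  have heq : ∫ x in (0 : ℝ)..L, f x * (g x - g c) = ∫ x in (0 : ℝ)..L, f x * g x := by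
    simp only [mul_sub]
    rw [intervalIntegral.integral_sub, intervalIntegral.integral_mul_const, h0]
    · ring
    all_goals exact Continuous.intervalIntegrable (by fun_prop) _ _
  rwa [heq] at hpos

/-- Wirtinger's inequality with Dirichlet conditions. -/
theorem dirichlet_wirtinger {U u : ℝ → ℝ} {L : ℝ} (hL : 0 < L) (hU : ∀ x, HasDerivAt U (u x) x)
    (hu : Continuous u) (h0 : U 0 = 0) (h1 : U L = 0) :
    (Real.pi / L) ^ 2 * ∫ x in (0 : ℝ)..L, U x ^ 2 ≤ ∫ x in (0 : ℝ)..L, u x ^ 2 := by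
  have hUc : Continuous U := continuous_iff_continuousAt.2 fun x => (hU x).continuousAt
  have key : ∀ κ ∈ Ioo 0 (Real.pi / L),
      κ ^ 2 * ∫ x in (0 : ℝ)..L, U x ^ 2 ≤ ∫ x in (0 : ℝ)..L, u x ^ 2 := by
    intro κ hκ
    have hκL : κ * L < Real.pi := (lt_div_iff₀ hL).1 hκ.2
    -- A solution of the Riccati equation `t' = -κ² - t²`, regular on `[0, L]` because `κ < π / L`.
    -- It makes `u² - κ² U²` equal to a square plus the derivative of `t U²`; the sharp constant
    -- follows by letting `κ` tend to `π / L`.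
    set t : ℝ → ℝ := fun x => -(κ * Real.tan (κ * (x - L / 2))) with ht
    have hcos : ∀ x ∈ Icc 0 L, Real.cos (κ * (x - L / 2)) ≠ 0 := fun x hx =>
      (Real.cos_pos_of_mem_Ioo ⟨by nlinarith [hx.1, hκ.1], by nlinarith [hx.2, hκ.1]⟩).ne'
    have htd : ∀ x ∈ Icc 0 L, HasDerivAt t (-κ ^ 2 - t x ^ 2) x := by
      intro x hx
      have h2 := ((Real.hasDerivAt_tan (hcos x hx)).comp x
        (((hasDerivAt_id x).sub_const (L / 2)).const_mul κ)).const_mul κ |>.neg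
      convert! h2 using 1
      have := hcos x hx
      simp only [ht, Real.tan_eq_sin_div_cos]
      generalize κ * (x - L / 2) = y at this
      have hsc := Real.sin_sq_add_cos_sq y
      field_simp
      linear_combination -κ ^ 2 * hsc
    have htc : ContinuousOn t (Icc 0 L) := fun x hx => (htd x hx).continuousAt.continuousWithinAt
    have hder : ∀ x ∈ uIcc 0 L, HasDerivAt (fun x => t x * U x ^ 2)
        (u x ^ 2 - κ ^ 2 * U x ^ 2 - (u x - t x * U x) ^ 2) x := by
      intro x hx
      rw [uIcc_of_le hL.le] at hx
      convert! (htd x hx).mul ((hU x).pow 2) using 1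
      simp; ring
    have hint : ContinuousOn (fun x => (u x - t x * U x) ^ 2) (uIcc 0 L) := by
      rw [uIcc_of_le hL.le]; fun_prop
    have hI1 : IntervalIntegrable (fun x => u x ^ 2) volume 0 L :=
      (hu.pow 2).intervalIntegrable _ _
    have hI2 : IntervalIntegrable (fun x => κ ^ 2 * U x ^ 2) volume 0 L :=
      (continuous_const.mul (hUc.pow 2)).intervalIntegrable _ _
    have hI3 := hint.intervalIntegrable (μ := volume)
    have := intervalIntegral.integral_eq_sub_of_hasDerivAt hder ((hI1.sub hI2).sub hI3)
    rw [intervalIntegral.integral_sub (hI1.sub hI2) hI3, intervalIntegral.integral_sub hI1 hI2,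
      intervalIntegral.integral_const_mul, h0, h1] at this
    have hnn : 0 ≤ ∫ x in (0 : ℝ)..L, (u x - t x * U x) ^ 2 :=
      intervalIntegral.integral_nonneg hL.le fun x _ => sq_nonneg _
    linarith
  have hπ : 0 < Real.pi / L := div_pos Real.pi_pos hL
  have hlim : Tendsto (fun κ : ℝ => κ ^ 2 * ∫ x in (0 : ℝ)..L, U x ^ 2) (𝓝[<] (Real.pi / L))
      (𝓝 ((Real.pi / L) ^ 2 * ∫ x in (0 : ℝ)..L, U x ^ 2)) :=
    (Continuous.tendsto (by fun_prop) _).mono_left nhdsWithin_le_nhds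
  exact le_of_tendsto hlim (eventually_of_mem (Ioo_mem_nhdsLT hπ) key)

/-- Wirtinger's inequality for functions with zero mean (Neumann conditions). -/
theorem mean_zero_wirtinger {u v : ℝ → ℝ} {L : ℝ} (hL : 0 < L) (hu : ∀ x, HasDerivAt u (v x) x)
    (hv : Continuous v) (h0 : ∫ x in (0 : ℝ)..L, u x = 0) :
    (Real.pi / L) ^ 2 * ∫ x in (0 : ℝ)..L, u x ^ 2 ≤ ∫ x in (0 : ℝ)..L, v x ^ 2 := by
  have huc : Continuous u := continuous_iff_continuousAt.2 fun x => (hu x).continuousAt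
  set U : ℝ → ℝ := fun t => ∫ x in (0 : ℝ)..t, u x with hUdef
  have hU : ∀ x, HasDerivAt U (u x) x := fun x => (huc.integral_hasStrictDerivAt 0 x).hasDerivAt
  have hUc : Continuous U := continuous_iff_continuousAt.2 fun x => (hU x).continuousAt
  have hU0 : U 0 = 0 := by simp [hUdef]
  have hUL : U L = 0 := h0
  have hW := dirichlet_wirtinger hL hU huc hU0 hUL
  set κ := Real.pi / L with hκ
  have hparts : ∫ x in (0 : ℝ)..L, (u x ^ 2 + U x * v x) = 0 := by
    rw [intervalIntegral.integral_eq_sub_of_hasDerivAt (f := fun x => U x * u x)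
      (fun x _ => by convert! (hU x).mul (hu x) using 1; ring)
      ((by fun_prop : Continuous fun x => u x ^ 2 + U x * v x).intervalIntegrable _ _), hU0, hUL]
    ring
  -- Since `∫ U v = -∫ u²`, this square gives `2 κ² ∫ u² ≤ κ⁴ ∫ U² + ∫ v²`, and the Dirichlet
  -- inequality bounds `κ⁴ ∫ U²` by `κ² ∫ u²`.
  have hsq : 0 ≤ ∫ x in (0 : ℝ)..L, (κ ^ 2 * U x + v x) ^ 2 :=
    intervalIntegral.integral_nonneg hL.le fun x _ => sq_nonneg _
  have hexp : ∫ x in (0 : ℝ)..L, (κ ^ 2 * U x + v x) ^ 2 =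
      κ ^ 4 * (∫ x in (0 : ℝ)..L, U x ^ 2) + (∫ x in (0 : ℝ)..L, v x ^ 2)
        - 2 * κ ^ 2 * (∫ x in (0 : ℝ)..L, u x ^ 2) := by
    have : ∀ x, (κ ^ 2 * U x + v x) ^ 2 = κ ^ 4 * U x ^ 2 + v x ^ 2 - 2 * κ ^ 2 * u x ^ 2
        + 2 * κ ^ 2 * (u x ^ 2 + U x * v x) := fun x => by ring
    simp only [this]
    rw [intervalIntegral.integral_add, intervalIntegral.integral_sub, intervalIntegral.integral_add]
    · simp only [intervalIntegral.integral_const_mul, hparts]; ring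
    all_goals exact Continuous.intervalIntegrable (by fun_prop) _ _
  rw [hexp] at hsq
  nlinarith [mul_le_mul_of_nonneg_left hW (sq_nonneg κ)]

/-- The integral over `[0, X]` of a function symmetric about `X / 2`. -/
theorem integral_eq_two_mul_half {f : ℝ → ℝ} {X : ℝ} (hf : Continuous f)
    (hs : ∀ x, f (X - x) = f x) :
    ∫ x in (0 : ℝ)..X, f x = 2 * ∫ x in (0 : ℝ)..(X / 2), f x := by
  have h1 : ∫ x in (X / 2)..X, f x = ∫ x in (0 : ℝ)..(X / 2), f x := by
    have := intervalIntegral.integral_comp_sub_left (a := 0) (b := X / 2) f X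
    simp only [hs] at this
    rw [this]
    congr 1 <;> ring
  rw [← intervalIntegral.integral_add_adjacent_intervals (hf.intervalIntegrable 0 (X / 2))
    (hf.intervalIntegrable (X / 2) X), h1]
  ring

/-! ### Period bound and energy excess of a general oscillation -/

namespace IsOscillation

variable {V F Q Q' h p : ℝ → ℝ} {X : ℝ}

theorem vel_periodic (ho : IsOscillation F h p) (hper : Function.Periodic h X) :
    Function.Periodic p X := fun x => by
  have h1 := (ho.hasDerivAt (x + X)).comp_add_const x X
  simp only [hper _] at h1
  exact h1.unique (ho.hasDerivAt x)

theorem vel_zero (ho : IsOscillation F h p) (hmin : ∀ x, h 0 ≤ h x) : p 0 = 0 :=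
  IsLocalMin.hasDerivAt_eq_zero (Eventually.of_forall hmin) (ho.hasDerivAt 0)

theorem vel_neg (ho : IsOscillation F h p) (heven : ∀ x, h (-x) = h x) (x : ℝ) :
    p (-x) = -p x := by
  have h1 := (ho.reflect 0).hasDerivAt (-x)
  simp only [zero_sub, heven, neg_neg] at h1
  exact (ho.hasDerivAt (-x)).unique h1

theorem vel_half (ho : IsOscillation F h p) (heven : ∀ x, h (-x) = h x)
    (hper : Function.Periodic h X) : p (X / 2) = 0 := by
  have h1 := ho.vel_periodic hper (-(X / 2))
  rw [ho.vel_neg heven, show -(X / 2) + X = X / 2 by ring] at h1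
  linarith

theorem even (hF : ∀ y, 0 < y → HasDerivAt F (Q y) y) (hQ : ContinuousOn Q (Ioi 0))
    (ho : IsOscillation F h p) (hX : IsLeast (positivePeriods h) X) (hmin : ∀ x, h 0 ≤ h x) (x : ℝ) :
    h (-x) = h x := by
  have := symm_of_vel_eq_zero hF hQ ho hX.1.1 hX.1.2 (ho.vel_zero hmin) x
  rwa [mul_zero, zero_sub] at this

theorem strictMonoOn_half (hF : ∀ y, 0 < y → HasDerivAt F (Q y) y) (hQ : ContinuousOn Q (Ioi 0))
    (ho : IsOscillation F h p) (hX : IsLeast (positivePeriods h) X) (hmin : ∀ x, h 0 ≤ h x) :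
    StrictMonoOn h (Icc 0 (X / 2)) := by
  refine strictMonoOn_of_deriv_pos (convex_Icc _ _) ho.continuous.continuousOn fun x hx => ?_
  rw [interior_Icc] at hx
  rw [(ho.hasDerivAt x).deriv]
  exact ho.vel_pos hF hQ hX hmin hx

/-- The stiffness at the mean height is below the square of the frequency, provided that the
stiffness `Q` is convex and strictly monotone. -/
theorem stiffness_mean_lt {σ : ℝ} (hV : ∀ y, 0 < y → HasDerivAt V (F y) y)
    (hF : ∀ y, 0 < y → HasDerivAt F (Q y) y) (hQ : ∀ y, 0 < y → HasDerivAt Q (Q' y) y)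
    (hconv : ∀ y, 0 < y → ∀ z, 0 < z → Q y + Q' y * (z - y) ≤ Q z)
    (hσ : ∀ y, 0 < y → 0 < σ * Q' y)
    (ho : IsOscillation F h p) (hX : IsLeast (positivePeriods h) X) (hmin : ∀ x, h 0 ≤ h x)
    {m : ℝ} (hm0 : 0 < m) (hm : ∫ x in (0 : ℝ)..X, h x = X * m) :
    Q m < (2 * Real.pi / X) ^ 2 := by
  have hX0 : 0 < X := hX.1.1
  have hQc : ContinuousOn Q (Ioi 0) := fun y hy => (hQ y hy).continuousAt.continuousWithinAt
  have hFc : ContinuousOn F (Ioi 0) := fun y hy => (hF y hy).continuousAt.continuousWithinAt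
  have heven := ho.even hF hQc hX hmin
  have hmono := ho.strictMonoOn_half hF hQc hX hmin
  have hhc := ho.continuous
  have hpc := ho.continuous_vel
  have hFhc := ho.continuous_comp hFc
  set ω := 2 * Real.pi / X with hω
  have hωX : ω * X = 2 * Real.pi := by rw [hω]; field_simp
  have hω0 : 0 < ω := by rw [hω]; exact div_pos Real.two_pi_pos hX0
  set L := X / 4 with hL
  have hL0 : 0 < L := by positivity
  -- `S` and `d` are, up to sign, the even and odd parts of `h` about the quarter period `L`: `h x =
  -- S x - d x` and `h (X / 2 - x) = S x + d x`.
  set S : ℝ → ℝ := fun x => (h x + h (X / 2 - x)) / 2 with hS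
  set S₁ : ℝ → ℝ := fun x => (p x - p (X / 2 - x)) / 2 with hS₁
  set S₂ : ℝ → ℝ := fun x => -(F (h x) + F (h (X / 2 - x))) / 2 with hS₂
  set d : ℝ → ℝ := fun x => (h (X / 2 - x) - h x) / 2 with hd
  set d₁ : ℝ → ℝ := fun x => -(p (X / 2 - x) + p x) / 2 with hd₁
  set d₂ : ℝ → ℝ := fun x => -(F (h (X / 2 - x)) - F (h x)) / 2 with hd₂
  have hr1 : ∀ x, HasDerivAt (fun x => h (X / 2 - x)) (-p (X / 2 - x)) x := fun x =>
    (ho.hasDerivAt _).comp_const_sub (X / 2) x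
  have hr2 : ∀ x, HasDerivAt (fun x => p (X / 2 - x)) (F (h (X / 2 - x))) x := fun x => by
    simpa using (ho.hasDerivAt_vel _).comp_const_sub (X / 2) x
  have hSd : ∀ x, HasDerivAt S (S₁ x) x := fun x =>
    ((ho.hasDerivAt x).add (hr1 x)).div_const 2
  have hS₁d : ∀ x, HasDerivAt S₁ (S₂ x) x := fun x => by
    convert! ((ho.hasDerivAt_vel x).sub (hr2 x)).div_const 2 using 1
    simp only [hS₂]; ring
  have hdd : ∀ x, HasDerivAt d (d₁ x) x := fun x => by
    convert! ((hr1 x).sub (ho.hasDerivAt x)).div_const 2 using 1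
    simp only [hd₁]; ring
  have hd₁d : ∀ x, HasDerivAt d₁ (d₂ x) x := fun x => by
    convert! (((hr2 x).add (ho.hasDerivAt_vel x)).neg).div_const 2 using 1
  have hSc : Continuous S := by fun_prop
  have hS₁c : Continuous S₁ := by fun_prop
  have hdc : Continuous d := by fun_prop
  have hd₂c : Continuous d₂ := by
    exact ((hFhc.comp (by fun_prop : Continuous fun x => X / 2 - x)).sub hFhc).neg.div_const 2
  have hlt : ∀ x ∈ Ico 0 L, h x < h (X / 2 - x) := fun x hx =>
    hmono ⟨hx.1, by linarith [hx.2]⟩ ⟨by linarith [hx.2], by linarith [hx.1]⟩ (by linarith [hx.2])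
  -- Where `S₁` vanishes the two velocities agree, hence by energy conservation so do the two
  -- potentials, and the sign of the sum of the forces is known. So `σ * S₁`, which starts at `0`,
  -- can never cross zero upwards, and `σ * S` decreases.
  have hcross : ∀ x ∈ Ico 0 L, σ * S₁ x = 0 → σ * S₂ x < 0 := by
    intro x hx h0
    have hσ0 : σ ≠ 0 := by
      rintro rfl
      simpa using hσ 1 one_pos
    have hpx : p x = p (X / 2 - x) := by
      have := (mul_eq_zero.1 h0).resolve_left hσ0
      simp only [hS₁] at this
      linarith
    have hen := ho.energy_eq hV x (X / 2 - x)
    rw [hpx] at hen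
    have := force_add_pos_of_potential_eq hV hF hQ hσ (ho.pos x) (hlt x hx) (by linarith)
    simp only [hS₂]
    linarith
  have hS₁le : ∀ x ∈ Icc 0 L, σ * S₁ x ≤ 0 := by
    refine image_le_of_deriv_right_lt_deriv_boundary (f' := fun x => σ * S₂ x) (B := fun _ => 0)
      (B' := fun _ => 0) (by fun_prop) (fun x _ => ((hS₁d x).const_mul σ).hasDerivWithinAt) ?_
      (fun x => hasDerivAt_const x 0) hcross
    simp only [hS₁, sub_zero]
    rw [ho.vel_zero hmin, ho.vel_half heven hX.1.2]
    simp
  have hS₁lt : ∀ x ∈ Ioo 0 L, σ * S₁ x < 0 := by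
    intro x hx
    refine lt_of_le_of_ne (hS₁le x (Ioo_subset_Icc_self hx)) fun h0 => ?_
    have hmax : IsLocalMax (fun x => σ * S₁ x) x :=
      eventually_of_mem (Ioo_mem_nhds hx.1 hx.2) fun y hy => by
        simp only [h0]; exact hS₁le y (Ioo_subset_Icc_self hy)
    have := hmax.hasDerivAt_eq_zero ((hS₁d x).const_mul σ)
    exact absurd this (hcross x (Ioo_subset_Ico_self hx) h0).ne
  have hSanti : StrictAntiOn (fun x => σ * (S x - m)) (Icc 0 L) := by
    refine strictAntiOn_of_deriv_neg (convex_Icc _ _) (by fun_prop) fun x hx => ?_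
    rw [interior_Icc] at hx
    rw [(((hSd x).sub_const m).const_mul σ).deriv]
    exact hS₁lt x hx
  have hSmean : ∫ x in (0 : ℝ)..L, σ * (S x - m) = 0 := by
    have h1 : ∫ x in (0 : ℝ)..L, h (X / 2 - x) = ∫ x in L..(X / 2), h x := by
      rw [intervalIntegral.integral_comp_sub_left (fun x => h x)]
      congr 1
      · rw [hL]; ring
      · ring
    have h2 := intervalIntegral.integral_add_adjacent_intervals (hhc.intervalIntegrable 0 L)
      (hhc.intervalIntegrable (μ := volume) L (X / 2))
    have h3 := integral_eq_two_mul_half (X := X) hhc fun x => by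
      rw [← heven, neg_sub]; exact hX.1.2.sub_eq x
    rw [intervalIntegral.integral_const_mul, intervalIntegral.integral_sub
      (hSc.intervalIntegrable _ _) (by simp), intervalIntegral.integral_div,
      intervalIntegral.integral_add (hhc.intervalIntegrable _ _)
      (Continuous.intervalIntegrable (by fun_prop) _ _), h1, h2]
    simp only [intervalIntegral.integral_const, smul_eq_mul]
    rw [show ∫ x in (0 : ℝ)..(X / 2), h x = X * m / 2 by linarith]
    rw [hL]; ring
  have hcpos : ∀ x ∈ Ico 0 L, 0 < Real.cos (ω * x) := fun x hx =>
    Real.cos_pos_of_mem_Ioo ⟨by nlinarith [hx.1, Real.pi_pos], by nlinarith [hx.2]⟩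
  have hωL : ω * L = Real.pi / 2 := by rw [hL]; linarith
  have hcnn : ∀ x ∈ Icc 0 L, 0 ≤ Real.cos (ω * x) := fun x hx =>
    Real.cos_nonneg_of_mem_Icc ⟨by nlinarith [hx.1, Real.pi_pos], by nlinarith [hx.2]⟩
  have hdnn : ∀ x ∈ Icc 0 L, 0 ≤ d x := by
    intro x hx
    have := hmono.monotoneOn (a := x) (b := X / 2 - x) ⟨hx.1, by linarith [hx.2]⟩
      ⟨by linarith [hx.2], by linarith [hx.1]⟩ (by linarith [hx.2])
    simp only [hd]; linarith
  have hdpos : ∀ x ∈ Ico 0 L, 0 < d x := fun x hx => by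
    have := hlt x hx
    simp only [hd]; linarith
  have hganti : StrictAntiOn (fun x => d x * Real.cos (ω * x)) (Icc 0 L) := by
    intro x hx y hy hxy
    have hxI : x ∈ Ico 0 L := ⟨hx.1, hxy.trans_le hy.2⟩
    have h1 : d y ≤ d x := by
      have e1 := hmono.monotoneOn (a := x) (b := y) ⟨hx.1, by linarith [hx.2]⟩
        ⟨hy.1, by linarith [hy.2]⟩ hxy.le
      have e2 := hmono.monotoneOn (a := X / 2 - y) (b := X / 2 - x)
        ⟨by linarith [hy.2], by linarith [hy.1]⟩ ⟨by linarith [hx.2], by linarith [hx.1]⟩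
        (by linarith)
      simp only [hd]; linarith
    have h2 : Real.cos (ω * y) < Real.cos (ω * x) :=
      Real.cos_lt_cos_of_nonneg_of_le_pi_div_two (mul_nonneg hω0.le hx.1)
        (by nlinarith [hy.2]) (by nlinarith)
    calc d y * Real.cos (ω * y) ≤ d x * Real.cos (ω * y) :=
          mul_le_mul_of_nonneg_right h1 (hcnn y hy)
      _ < d x * Real.cos (ω * x) := mul_lt_mul_of_pos_left h2 (hdpos x hxI)
  have hcheb := integral_mul_pos_of_strictAntiOn hL0 (by fun_prop) (by fun_prop) hSanti hganti
    hSmean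
  have hJ : 0 < ∫ x in (0 : ℝ)..L, d x * Real.cos (ω * x) :=
    intervalIntegral.integral_pos hL0 (by fun_prop)
      (fun x hx => mul_nonneg (hdnn x (Ioc_subset_Icc_self hx)) (hcnn x (Ioc_subset_Icc_self hx)))
      ⟨0, ⟨le_rfl, hL0.le⟩, mul_pos (hdpos 0 ⟨le_rfl, hL0⟩) (hcpos 0 ⟨le_rfl, hL0⟩)⟩
  -- The integrand is the derivative of `d' cos(ωx) + ω d sin(ωx)`. The boundary terms vanish
  -- because `d' 0 = 0`, `d L = 0` and `cos (ω L) = 0`.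
  have hwr : ∫ x in (0 : ℝ)..L, (d₂ x * Real.cos (ω * x) + ω ^ 2 * (d x * Real.cos (ω * x))) = 0 := by
    have hder : ∀ x ∈ uIcc 0 L, HasDerivAt
        (fun x => d₁ x * Real.cos (ω * x) + d x * (ω * Real.sin (ω * x)))
        (d₂ x * Real.cos (ω * x) + ω ^ 2 * (d x * Real.cos (ω * x))) x := fun x _ => by
      have hlin : HasDerivAt (fun x => ω * x) ω x := by simpa using (hasDerivAt_id x).const_mul ω
      convert! ((hd₁d x).mul hlin.cos).add ((hdd x).mul (hlin.sin.const_mul ω)) using 1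
      ring
    rw [intervalIntegral.integral_eq_sub_of_hasDerivAt hder
      (Continuous.intervalIntegrable (by fun_prop) _ _), hωL, Real.cos_pi_div_two]
    have e1 : d L = 0 := by
      simp only [hd]; rw [show X / 2 - L = L by rw [hL]; ring]; ring
    have e2 : d₁ 0 = 0 := by
      simp only [hd₁, sub_zero]; rw [ho.vel_zero hmin, ho.vel_half heven hX.1.2]; simp
    rw [e1, e2]; simp
  -- The midpoint rule bounds `-d''` below by `d * Q (S x)`, and the tangent line of `Q` at `m`
  -- linearizes `Q (S x)`.
  have hle : ∫ x in (0 : ℝ)..L, (d₂ x * Real.cos (ω * x) + ω ^ 2 * (d x * Real.cos (ω * x))) ≤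
      ∫ x in (0 : ℝ)..L, ((ω ^ 2 - Q m) * (d x * Real.cos (ω * x))
        - Q' m * ((S x - m) * (d x * Real.cos (ω * x)))) := by
    refine intervalIntegral.integral_mono_on hL0.le
      (Continuous.intervalIntegrable (by fun_prop) _ _)
      (Continuous.intervalIntegrable (by fun_prop) _ _) fun x hx => ?_
    have hSx : 0 < S x := by
      have := ho.pos x; have := ho.pos (X / 2 - x); simp only [hS]; positivity
    have h1 := midpoint_le hF hconv (hdnn x hx) (s := S x) (by
      have := ho.pos x; simp only [hS, hd]; linarith)
    rw [show S x + d x = h (X / 2 - x) by simp only [hS, hd]; ring,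
      show S x - d x = h x by simp only [hS, hd]; ring] at h1
    have h2 := mul_le_mul_of_nonneg_left (hconv m hm0 (S x) hSx) (hdnn x hx)
    have h3 : d₂ x ≤ -(d x * (Q m + Q' m * (S x - m))) := by
      simp only [hd₂] at h1 h2 ⊢; linarith
    have h4 := mul_le_mul_of_nonneg_right h3 (hcnn x hx)
    linarith
  rw [hwr, intervalIntegral.integral_sub (Continuous.intervalIntegrable (by fun_prop) _ _)
    (Continuous.intervalIntegrable (by fun_prop) _ _), intervalIntegral.integral_const_mul,
    intervalIntegral.integral_const_mul] at hle
  simp only [mul_assoc σ] at hcheb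
  rw [intervalIntegral.integral_const_mul] at hcheb
  have hprod := mul_pos (hσ m hm0) hcheb
  set I := ∫ x in (0 : ℝ)..L, (S x - m) * (d x * Real.cos (ω * x))
  -- `σ * Q' m` and `σ * I` are both positive; their product is `σ ^ 2 * (Q' m * I)`.
  have hI : 0 < Q' m * I := by
    refine pos_of_mul_pos_right (a := σ ^ 2) (by linarith) (sq_nonneg σ)
  have : 0 < (ω ^ 2 - Q m) * ∫ x in (0 : ℝ)..L, d x * Real.cos (ω * x) := by linarith
  linarith [pos_of_mul_pos_left this hJ.le]

/-- Multiply `h'' = -F h` by `h - m` and integrate by parts over a period. This trades the force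
term of the quadrature bounds for kinetic energy. -/
theorem integral_force_mul (hF : ContinuousOn F (Ioi 0)) (ho : IsOscillation F h p)
    (hper : Function.Periodic h X) (m : ℝ) :
    ∫ x in (0 : ℝ)..X, F (h x) * (h x - m) = ∫ x in (0 : ℝ)..X, p x ^ 2 := by
  have hFhc := ho.continuous_comp hF
  have hhc := ho.continuous
  have hpc := ho.continuous_vel
  have hder : ∀ x ∈ uIcc 0 X, HasDerivAt (fun x => p x * (h x - m))
      (p x ^ 2 - F (h x) * (h x - m)) x := fun x _ => by
    convert! (ho.hasDerivAt_vel x).mul ((ho.hasDerivAt x).sub_const m) using 1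
    ring
  have hc : Continuous fun x => F (h x) * (h x - m) := hFhc.mul (hhc.sub continuous_const)
  have hc' : Continuous fun x => p x ^ 2 := by fun_prop
  have := intervalIntegral.integral_eq_sub_of_hasDerivAt hder ((hc'.sub hc).intervalIntegrable _ _)
  rw [intervalIntegral.integral_sub (hc'.intervalIntegrable _ _)
    (hc.intervalIntegrable _ _)] at this
  have hpX := ho.vel_periodic hper 0
  have hhX := hper 0
  rw [zero_add] at hpX hhX
  rw [hpX, hhX] at this
  linarith

/-- A periodic oscillation has more energy than its mean, for a convex strictly monotone
stiffness. -/
theorem energy_gap_pos {σ : ℝ} (hV : ∀ y, 0 < y → HasDerivAt V (F y) y)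
    (hF : ∀ y, 0 < y → HasDerivAt F (Q y) y) (hQ : ∀ y, 0 < y → HasDerivAt Q (Q' y) y)
    (hconv : ∀ y, 0 < y → ∀ z, 0 < z → Q y + Q' y * (z - y) ≤ Q z)
    (hσ : ∀ y, 0 < y → 0 < σ * Q' y)
    (ho : IsOscillation F h p) (hX : IsLeast (positivePeriods h) X) (hmin : ∀ x, h 0 ≤ h x)
    {m : ℝ} (hm0 : 0 < m) (hm : ∫ x in (0 : ℝ)..X, h x = X * m) :
    0 < ∫ x in (0 : ℝ)..X, (1 / 2 * p x ^ 2 - (V (h x) - V m)) := by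
  have hX0 : 0 < X := hX.1.1
  have hQc : ContinuousOn Q (Ioi 0) := fun y hy => (hQ y hy).continuousAt.continuousWithinAt
  have hFc : ContinuousOn F (Ioi 0) := fun y hy => (hF y hy).continuousAt.continuousWithinAt
  have hVc : ContinuousOn V (Ioi 0) := fun y hy => (hV y hy).continuousAt.continuousWithinAt
  have hFhc := ho.continuous_comp hFc
  have hVhc := ho.continuous_comp hVc
  have hhc := ho.continuous
  have hpc := ho.continuous_vel
  have heven := ho.even hF hQc hX hmin
  have hsymm : ∀ x, h (X - x) = h x := fun x => by
    rw [← heven, neg_sub]; exact hX.1.2.sub_eq x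
  have hpsymm : ∀ x, p (X - x) = -p x := fun x => by
    rw [← ho.vel_neg heven x, ← ho.vel_periodic hX.1.2 (-x)]; congr 1; ring
  have hlt := ho.stiffness_mean_lt hV hF hQ hconv hσ hX hmin hm0 hm
  have hdev : ∫ x in (0 : ℝ)..X, (h x - m) = 0 := by
    rw [intervalIntegral.integral_sub (hhc.intervalIntegrable _ _) (by simp), hm]
    simp
  -- By symmetry the mean over a half period is also `m`, so the Neumann form of Wirtinger's
  -- inequality on `[0, X / 2]` gives the periodic constant `2π / X`.
  have h2 : ∫ x in (0 : ℝ)..(X / 2), (h x - m) = 0 := by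
    have := integral_eq_two_mul_half (X := X) (f := fun x => h x - m) (by fun_prop)
      fun x => by rw [hsymm]
    linarith
  have hw := mean_zero_wirtinger (half_pos hX0) (fun x => (ho.hasDerivAt x).sub_const m) hpc h2
  have e1 := integral_eq_two_mul_half (X := X) (f := fun x => (h x - m) ^ 2) (by fun_prop)
    fun x => by rw [hsymm]
  have e2 := integral_eq_two_mul_half (X := X) (f := fun x => p x ^ 2) (by fun_prop)
    fun x => by rw [hpsymm, neg_sq]
  have hc0 : Continuous fun x => 1 / 2 * p x ^ 2 := by fun_prop
  have hc1 : Continuous fun x => 2 / 3 * (F m * (h x - m)) := by fun_prop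
  have hc2 : Continuous fun x => 1 / 3 * (F (h x) * (h x - m)) :=
    continuous_const.mul (hFhc.mul (hhc.sub continuous_const))
  have hc3 : Continuous fun x => 1 / 6 * (Q m * (h x - m) ^ 2) := by fun_prop
  have hmain : ∫ x in (0 : ℝ)..X, (1 / 2 * p x ^ 2 - (2 / 3 * (F m * (h x - m))
      + 1 / 3 * (F (h x) * (h x - m)) + 1 / 6 * (Q m * (h x - m) ^ 2))) ≤
      ∫ x in (0 : ℝ)..X, (1 / 2 * p x ^ 2 - (V (h x) - V m)) := by
    refine intervalIntegral.integral_mono_on hX0.le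
      ((hc0.sub ((hc1.add hc2).add hc3)).intervalIntegrable _ _)
      ((hc0.sub (hVhc.sub continuous_const)).intervalIntegrable _ _) fun x _ => ?_
    linarith [potential_sub_le hV hF hQ hconv hm0 (ho.pos x)]
  -- After integration the lower bound is `(∫ p² - Q m * ∫ (h - m)²) / 6`: the term with `F m` has
  -- mean zero, and the term with `F h` takes away a third of `∫ p²`.
  refine lt_of_lt_of_le ?_ hmain
  rw [intervalIntegral.integral_sub, intervalIntegral.integral_add, intervalIntegral.integral_add]
  · simp only [intervalIntegral.integral_const_mul]
    rw [hdev, ho.integral_force_mul hFc hX.1.2 m]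
    have hpos : 0 < ∫ x in (0 : ℝ)..X, (h x - m) ^ 2 := by
      have hne : ∃ c ∈ Icc 0 X, h c - m ≠ 0 := by
        by_contra hcon
        push Not at hcon
        have a1 := hcon 0 ⟨le_rfl, hX0.le⟩
        have a2 := hcon (X / 2) ⟨by linarith, by linarith⟩
        have := ho.strictMonoOn_half hF hQc hX hmin (left_mem_Icc.2 (by linarith))
          (right_mem_Icc.2 (by linarith)) (half_pos hX0)
        linarith
      obtain ⟨c, hc, hcne⟩ := hne
      exact intervalIntegral.integral_pos hX0 (by fun_prop) (fun x _ => sq_nonneg _)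
        ⟨c, hc, by positivity⟩
    have hω : (Real.pi / (X / 2)) = 2 * Real.pi / X := by field_simp
    rw [hω] at hw
    have : 0 < ((2 * Real.pi / X) ^ 2 - Q m) * ∫ x in (0 : ℝ)..X, (h x - m) ^ 2 :=
      mul_pos (sub_pos.2 hlt) hpos
    have hw' : (2 * Real.pi / X) ^ 2 * ∫ x in (0 : ℝ)..X, (h x - m) ^ 2 ≤
        ∫ x in (0 : ℝ)..X, p x ^ 2 := by rw [e1, e2]; linarith
    linarith
  · exact hc1.intervalIntegrable _ _
  · exact hc2.intervalIntegrable _ _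
  · exact (hc1.add hc2).intervalIntegrable _ _
  · exact hc3.intervalIntegrable _ _
  · exact hc0.intervalIntegrable _ _
  · exact ((hc1.add hc2).add hc3).intervalIntegrable _ _

/-- A harmonic oscillation has the same energy as its mean. -/
theorem energy_gap_eq_zero {B : ℝ} (hV : ∀ y, 0 < y → HasDerivAt V (F y) y)
    (hF : ∀ y, 0 < y → HasDerivAt F B y)
    (ho : IsOscillation F h p) (hper : Function.Periodic h X)
    {m : ℝ} (hm0 : 0 < m) (hm : ∫ x in (0 : ℝ)..X, h x = X * m) :
    ∫ x in (0 : ℝ)..X, (1 / 2 * p x ^ 2 - (V (h x) - V m)) = 0 := by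
  have hFc : ContinuousOn F (Ioi 0) := fun y hy => (hF y hy).continuousAt.continuousWithinAt
  have hVc : ContinuousOn V (Ioi 0) := fun y hy => (hV y hy).continuousAt.continuousWithinAt
  have hFhc := ho.continuous_comp hFc
  have hVhc := ho.continuous_comp hVc
  have hhc := ho.continuous
  have hpc := ho.continuous_vel
  have hdev : ∫ x in (0 : ℝ)..X, (h x - m) = 0 := by
    rw [intervalIntegral.integral_sub (hhc.intervalIntegrable _ _) (by simp), hm]
    simp
  -- A constant stiffness satisfies the convexity hypothesis with equality. The bound with `y` and
  -- `m` exchanged is then the reverse inequality, and the trapezoidal rule is exact.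
  have hpt : ∀ y, 0 < y → V y - V m = 1 / 2 * (F m * (y - m)) + 1 / 2 * (F y * (y - m)) := by
    intro y hy
    have h1 := potential_sub_le (Q' := fun _ => 0) hV hF (fun y _ => hasDerivAt_const y B)
      (by simp) hm0 hy
    have h2 := potential_sub_le (Q' := fun _ => 0) hV hF (fun y _ => hasDerivAt_const y B)
      (by simp) hy hm0
    have hlin : F y - F m = B * (y - m) := by
      have h3 := monotoneOn_trapezoid_sub (Q' := fun _ => 0) hF
        (fun y _ => hasDerivAt_const y B) (by simp) hm0
      have h4 := monotoneOn_trapezoid_sub (Q' := fun _ => 0) (fun y hy => (hF y hy).neg)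
        (fun y _ => hasDerivAt_const y (-B)) (by simp) hm0
      rcases le_total y m with hle | hle
      · have a1 := h3 (mem_Ioi.2 hy) (mem_Ioi.2 hm0) hle
        have a2 := h4 (mem_Ioi.2 hy) (mem_Ioi.2 hm0) hle
        simp at a1 a2
        linarith
      · have a1 := h3 (mem_Ioi.2 hm0) (mem_Ioi.2 hy) hle
        have a2 := h4 (mem_Ioi.2 hm0) (mem_Ioi.2 hy) hle
        simp at a1 a2
        linarith
    have hFy : F y = F m + B * (y - m) := by linarith
    rw [hFy] at h1 h2 ⊢
    nlinarith
  have hc0 : Continuous fun x => 1 / 2 * p x ^ 2 := by fun_prop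
  have hc1 : Continuous fun x => 1 / 2 * (F m * (h x - m)) := by fun_prop
  have hc2 : Continuous fun x => 1 / 2 * (F (h x) * (h x - m)) :=
    continuous_const.mul (hFhc.mul (hhc.sub continuous_const))
  simp only [fun x => hpt (h x) (ho.pos x)]
  rw [intervalIntegral.integral_sub, intervalIntegral.integral_add]
  · simp only [intervalIntegral.integral_const_mul]
    rw [hdev, ho.integral_force_mul hFc hper m]
    ring
  · exact hc1.intervalIntegrable _ _
  · exact hc2.intervalIntegrable _ _
  · exact hc0.intervalIntegrable _ _
  · exact (hc1.add hc2).intervalIntegrable _ _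

end IsOscillation

/-! ### Steady states with power-law coefficients; the cases `q ≥ 2`, `q < 1` and `q = 1` -/

/-- Bernoulli's inequality for the convex range of exponents. -/
theorem one_add_mul_sub_one_le_rpow {a t : ℝ} (ha : 1 ≤ a ∨ a ≤ 0) (ht : 0 < t) :
    1 + a * (t - 1) ≤ t ^ a := by
  rcases ha with ha | ha
  · have := one_add_mul_self_le_rpow_one_add (s := t - 1) (by linarith) ha
    rwa [add_sub_cancel] at this
  · rw [Real.rpow_def_of_pos ht]
    -- `t ^ a ≥ 1 + a log t`, and `a ≤ 0` turns `log t ≤ t - 1` into `a log t ≥ a (t - 1)`.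
    nlinarith [Real.add_one_le_exp (Real.log t * a), Real.log_le_sub_one_of_pos ht]

/-- The graph of a convex power lies above its tangent lines. -/
theorem rpow_tangent_le {a y z : ℝ} (ha : 1 ≤ a ∨ a ≤ 0) (hy : 0 < y) (hz : 0 < z) :
    y ^ a + a * y ^ (a - 1) * (z - y) ≤ z ^ a := by
  have h := mul_le_mul_of_nonneg_left (one_add_mul_sub_one_le_rpow ha (div_pos hz hy))
    (Real.rpow_pos_of_pos hy a).le
  rw [← Real.mul_rpow hy.le (div_pos hz hy).le, mul_div_cancel₀ _ hy.ne'] at h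
  rw [Real.rpow_sub_one hy.ne']
  calc y ^ a + a * (y ^ a / y) * (z - y) = y ^ a * (1 + a * (z / y - 1)) := by field_simp
    _ ≤ z ^ a := h

section

variable {n m q B X : ℝ} {H h : ℝ → ℝ}

theorem IsEnergyPotential.hasDerivAt_deriv
    (hH : IsEnergyPotential (fun y => y ^ n) (fun y => B * y ^ m) H) (hq : q = m - n + 1)
    {y : ℝ} (hy : 0 < y) : HasDerivAt (deriv H) (B * y ^ (q - 1)) y := by
  have := (hH y hy).2
  rwa [mul_div_assoc, ← Real.rpow_sub hy, show m - n = q - 1 by linarith] at this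

/-- The first integral of the steady state equation. -/
theorem IsPositivePeriodicSteadyState.exists_isOscillation
    (hH : IsEnergyPotential (fun y => y ^ n) (fun y => B * y ^ m) H)
    (hss : IsPositivePeriodicSteadyState (fun y => y ^ n) (fun y => B * y ^ m) X h) :
    ∃ C, IsOscillation (fun y => deriv H y - C) h (deriv h) := by
  have hX := hss.leastPeriod.1
  have hpos := hss.pos
  have c3 : ContDiff ℝ 3 (deriv h) :=
    (contDiff_succ_iff_deriv.1 (show ContDiff ℝ (3 + 1) h from hss.contDiff)).2.2
  have c2 : ContDiff ℝ 2 (deriv (deriv h)) :=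
    (contDiff_succ_iff_deriv.1 (show ContDiff ℝ (2 + 1) (deriv h) from c3)).2.2
  have c1 : ContDiff ℝ 1 (deriv (deriv (deriv h))) :=
    (contDiff_succ_iff_deriv.1 (show ContDiff ℝ (1 + 1) (deriv (deriv h)) from c2)).2.2
  have d0 : Differentiable ℝ h := hss.contDiff.differentiable (by norm_num)
  have d1 : Differentiable ℝ (deriv h) := c3.differentiable (by norm_num)
  have d2 : Differentiable ℝ (deriv (deriv h)) := c2.differentiable (by norm_num)
  have d3 : Differentiable ℝ (deriv (deriv (deriv h))) := c1.differentiable (by norm_num)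
  have dpow : ∀ a : ℝ, Differentiable ℝ fun z => h z ^ a := fun a z =>
    (d0 z).rpow_const (Or.inl (hpos z).ne')
  have hiter : iteratedDeriv 3 h = deriv (deriv (deriv h)) := by
    simp [iteratedDeriv_succ, iteratedDeriv_zero]
  set w : ℝ → ℝ := fun z => h z ^ n * deriv (deriv (deriv h)) z + B * h z ^ m * deriv h z with hw
  have da : Differentiable ℝ fun z => h z ^ n * deriv (deriv (deriv h)) z := (dpow n).mul d3
  have db : Differentiable ℝ fun z => B * h z ^ m * deriv h z := ((dpow m).const_mul B).mul d1
  obtain ⟨c, hc⟩ : ∃ c, ∀ z, w z = c := by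
    refine ⟨w 0, fun z => is_const_of_deriv_eq_zero (da.add db) (fun x => ?_) z 0⟩
    have h1 := hss.steady x
    rw [hiter] at h1
    rw [deriv_add (da x) (db x)]
    linarith
  -- Dividing the constant flux `c` by `h^n` gives `g' = c h^(-n)`. As `g` is periodic and `h^(-n)`
  -- is positive, `c = 0`.
  set g : ℝ → ℝ := fun z => deriv (deriv h) z + deriv H (h z) with hg
  have hgd : ∀ z, HasDerivAt g (c * h z ^ (-n)) z := fun z => by
    have h1 := (d2 z).hasDerivAt.add ((hH (h z) (hpos z)).2.comp z (d0 z).hasDerivAt)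
    convert! h1 using 1
    rw [← hc z, hw, Real.rpow_neg (hpos z).le]
    have := (Real.rpow_pos_of_pos (hpos z) n).ne'
    field_simp
  have hd1per : Function.Periodic (deriv h) X := fun z => by
    rw [← deriv_comp_add_const]; congr 1; exact funext hX.2
  have hd2per : Function.Periodic (deriv (deriv h)) X := fun z => by
    rw [← deriv_comp_add_const]; congr 1; exact funext hd1per
  have hgX : g X = g 0 := by
    have e1 := hd2per 0
    have e2 := hX.2 0
    rw [zero_add] at e1 e2
    simp only [hg, e1, e2]
  have hint := intervalIntegral.integral_eq_sub_of_hasDerivAt (a := 0) (b := X)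
    (fun z _ => hgd z) (((dpow (-n)).continuous.const_mul c).intervalIntegrable _ _)
  rw [hgX, sub_self, intervalIntegral.integral_const_mul] at hint
  have hc0 : c = 0 := by
    refine (mul_eq_zero.1 hint).resolve_right (ne_of_gt ?_)
    exact intervalIntegral.intervalIntegral_pos_of_pos ((dpow (-n)).continuous.intervalIntegrable _ _)
      (fun z => Real.rpow_pos_of_pos (hpos z) _) hX.1
  have hgc : ∀ z, g z = g 0 := fun z =>
    is_const_of_deriv_eq_zero (fun z => (hgd z).differentiableAt)
      (fun z => by rw [(hgd z).deriv, hc0, zero_mul]) z 0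
  refine ⟨g 0, hpos, fun z => (d0 z).hasDerivAt, fun z => ?_⟩
  have h1 := hgc z
  have h2 : -(deriv H (h z) - g 0) = deriv (deriv h) z := by
    rw [← h1]; simp only [hg]; ring
  rw [h2]
  exact (d1 z).hasDerivAt

/-- The energy excess over the mean, computed from any point and modulo linear potentials. -/
theorem filmEnergy_sub_filmEnergy_mean (hH : IsEnergyPotential (fun y => y ^ n) (fun y => B * y ^ m) H)
    {F p : ℝ → ℝ} (ho : IsOscillation F h p) (hX0 : 0 < X) (hper : Function.Periodic h X)
    (C x₀ : ℝ) :
    filmEnergy H X h - filmEnergy H X (fun _ => meanOver X h) =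
      ∫ x in (0 : ℝ)..X, (1 / 2 * p (x + x₀) ^ 2
        - ((H (h (x + x₀)) - C * h (x + x₀)) - (H (meanOver X h) - C * meanOver X h))) := by
  set M := meanOver X h with hM
  have hhc := ho.continuous
  have hpc := ho.continuous_vel
  have hHc : ContinuousOn H (Ioi 0) := fun y hy => (hH y hy).1.continuousAt.continuousWithinAt
  have hHhc := ho.continuous_comp hHc
  have hmean : ∫ x in (0 : ℝ)..X, (h x - M) = 0 := by
    rw [intervalIntegral.integral_sub (hhc.intervalIntegrable _ _) (by simp), hM, meanOver]
    simp; field_simp; simp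
  have hder : deriv h = p := funext fun x => (ho.hasDerivAt x).deriv
  set G : ℝ → ℝ := fun x => 1 / 2 * p x ^ 2 - ((H (h x) - C * h x) - (H M - C * M)) with hG
  have hGper : Function.Periodic G X := fun x => by
    simp only [hG, hper x, ho.vel_periodic hper x]
  have hshift : ∫ x in (0 : ℝ)..X, G (x + x₀) = ∫ x in (0 : ℝ)..X, G x := by
    rw [intervalIntegral.integral_comp_add_right G, zero_add, add_comm X x₀,
      hGper.intervalIntegral_add_eq x₀ 0, zero_add]
  have hc1 : Continuous fun x => 1 / 2 * p x ^ 2 - H (h x) :=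
    (by fun_prop : Continuous fun x => 1 / 2 * p x ^ 2).sub hHhc
  have hc2 : Continuous fun x => C * (h x - M) := by fun_prop
  change _ = ∫ x in (0 : ℝ)..X, G (x + x₀)
  rw [hshift, filmEnergy, filmEnergy, hder]
  have : ∀ x, G x = (1 / 2 * p x ^ 2 - H (h x)) + C * (h x - M) + H M := fun x => by
    simp only [hG]; ring
  simp only [this]
  rw [intervalIntegral.integral_add, intervalIntegral.integral_add,
    intervalIntegral.integral_const_mul, hmean]
  · simp
  · exact hc1.intervalIntegrable _ _
  · exact hc2.intervalIntegrable _ _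
  · exact (hc1.add hc2).intervalIntegrable _ _
  · simp

theorem meanOver_pos (hX0 : 0 < X) (hc : Continuous h) (hpos : ∀ x, 0 < h x) :
    0 < meanOver X h :=
  mul_pos (by positivity) (intervalIntegral.intervalIntegral_pos_of_pos
    (hc.intervalIntegrable _ _) hpos hX0)

theorem integral_shift_eq_mul_meanOver (hX0 : 0 < X) (hper : Function.Periodic h X) (x₀ : ℝ) :
    ∫ x in (0 : ℝ)..X, h (x + x₀) = X * meanOver X h := by
  rw [intervalIntegral.integral_comp_add_right h, zero_add, add_comm X x₀,
      hper.intervalIntegral_add_eq x₀ 0, zero_add, meanOver]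
  field_simp

theorem positivePeriods_shift (h : ℝ → ℝ) (c : ℝ) :
    positivePeriods (fun x => h (x + c)) = positivePeriods h := by
  ext T
  refine and_congr_right fun _ => ⟨fun hT x => ?_, fun hT x => ?_⟩
  · have := hT (x - c)
    simp only at this
    rwa [sub_add_cancel, show x - c + T + c = x + T by ring] at this
  · simp only
    rw [show x + T + c = x + c + T by ring, hT]

/-- The stiffness `B y^(q-1)` is convex because its exponent is at least `1` or negative, and `σ = q
- 1` carries the sign of its derivative. -/
theorem filmEnergy_mean_lt (hB : 0 < B) (hq : q = m - n + 1)
    (hH : IsEnergyPotential (fun y => y ^ n) (fun y => B * y ^ m) H)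
    (hss : IsPositivePeriodicSteadyState (fun y => y ^ n) (fun y => B * y ^ m) X h)
    (hq' : 2 ≤ q ∨ q < 1) :
    filmEnergy H X (fun _ => meanOver X h) < filmEnergy H X h := by
  obtain ⟨C, ho⟩ := hss.exists_isOscillation hH
  have hX := hss.leastPeriod
  obtain ⟨x₀, hx₀⟩ := exists_min_of_continuous_periodic hX.1.1 ho.continuous hX.1.2
  rw [← sub_pos, filmEnergy_sub_filmEnergy_mean hH ho hX.1.1 hX.1.2 C x₀]
  refine (ho.shift x₀).energy_gap_pos (V := fun y => H y - C * y) (σ := q - 1)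
    (Q := fun y => B * y ^ (q - 1)) (Q' := fun y => B * ((q - 1) * y ^ (q - 1 - 1)))
    (fun y hy => ?_) (fun y hy => (hH.hasDerivAt_deriv hq hy).sub_const C) (fun y hy => ?_)
    (fun y hy z hz => ?_) (fun y hy => ?_) ?_ (fun x => ?_)
    (meanOver_pos hX.1.1 ho.continuous ho.pos) (integral_shift_eq_mul_meanOver hX.1.1 hX.1.2 x₀)
  · simpa using (hH y hy).1.hasDerivAt.fun_sub ((hasDerivAt_id y).const_mul C)
  · exact (Real.hasDerivAt_rpow_const (Or.inl hy.ne')).const_mul B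
  · have := mul_le_mul_of_nonneg_left (rpow_tangent_le (a := q - 1)
      (hq'.imp (fun h => by linarith) fun h => by linarith) hy hz) hB.le
    linarith
  · have h1 : 0 < (q - 1) ^ 2 := by
      have : q - 1 ≠ 0 := by rcases hq' with h | h <;> intro h0 <;> linarith
      positivity
    have := Real.rpow_pos_of_pos hy (q - 1 - 1)
    have : 0 < (q - 1) ^ 2 * B * y ^ (q - 1 - 1) := by positivity
    linarith
  · rwa [positivePeriods_shift]
  · simpa using hx₀ (x + x₀)

theorem filmEnergy_eq_filmEnergy_mean (hq : (1 : ℝ) = m - n + 1)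
    (hH : IsEnergyPotential (fun y => y ^ n) (fun y => B * y ^ m) H)
    (hss : IsPositivePeriodicSteadyState (fun y => y ^ n) (fun y => B * y ^ m) X h) :
    filmEnergy H X h = filmEnergy H X (fun _ => meanOver X h) := by
  obtain ⟨C, ho⟩ := hss.exists_isOscillation hH
  have hX := hss.leastPeriod
  rw [← sub_eq_zero, filmEnergy_sub_filmEnergy_mean hH ho hX.1.1 hX.1.2 C 0]
  refine (ho.shift 0).energy_gap_eq_zero (V := fun y => H y - C * y) (B := B)
    (fun y hy => ?_) (fun y hy => ?_) (by simpa using hX.1.2)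
    (meanOver_pos hX.1.1 ho.continuous ho.pos) (integral_shift_eq_mul_meanOver hX.1.1 hX.1.2 0)
  · simpa using (hH y hy).1.hasDerivAt.fun_sub ((hasDerivAt_id y).const_mul C)
  · simpa using (hH.hasDerivAt_deriv hq hy).sub_const C

end

/-! ### The canonical oscillator and the rescaling of steady states to it -/

theorem hasDerivAt_oscForce (q : ℝ) {y : ℝ} (hy : 0 < y) :
    HasDerivAt (oscForce q) (y ^ (q - 1)) y := by
  by_cases hq : q = 0
  · have : oscForce q = Real.log := funext fun z => by simp [oscForce, hq]
    rw [this, hq, zero_sub, Real.rpow_neg_one]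
    exact Real.hasDerivAt_log hy.ne'
  · have : oscForce q = fun z => (z ^ q - 1) / q := funext fun z => by simp [oscForce, hq]
    rw [this]
    have h1 := ((Real.hasDerivAt_rpow_const (p := q) (Or.inl hy.ne')).sub_const 1).div_const q
    rwa [mul_div_cancel_left₀ _ hq] at h1

theorem oscForce_one (q : ℝ) : oscForce q 1 = 0 := by simp [oscForce]

theorem contDiffAt_oscForce (q : ℝ) {y : ℝ} (hy : 0 < y) (n : ℕ) :
    ContDiffAt ℝ n (oscForce q) y := by
  by_cases hq : q = 0
  · have : oscForce q = Real.log := funext fun z => by simp [oscForce, hq]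
    rw [this]
    exact Real.contDiffAt_log.2 hy.ne'
  · have : oscForce q = fun z => (z ^ q - 1) / q := funext fun z => by simp [oscForce, hq]
    rw [this]
    exact ((Real.contDiffAt_rpow_const_of_ne hy.ne').sub contDiffAt_const).div_const q

theorem continuousOn_rpow_Ioi (a : ℝ) : ContinuousOn (fun y : ℝ => y ^ a) (Ioi 0) := fun y hy =>
  (Real.continuousAt_rpow_const y a (Or.inl (ne_of_gt hy))).continuousWithinAt

theorem continuousOn_oscForce (q : ℝ) : ContinuousOn (oscForce q) (Ioi 0) := fun _ hy =>
  (hasDerivAt_oscForce q hy).continuousAt.continuousWithinAt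

theorem strictMonoOn_oscForce (q : ℝ) : StrictMonoOn (oscForce q) (Ioi 0) := by
  refine strictMonoOn_of_deriv_pos (convex_Ioi 0) (continuousOn_oscForce q) fun y hy => ?_
  rw [interior_Ioi] at hy
  rw [(hasDerivAt_oscForce q hy).deriv]
  exact Real.rpow_pos_of_pos hy _

theorem IsOscillation.contDiff {q : ℝ} {k p : ℝ → ℝ} (ho : IsOscillation (oscForce q) k p) :
    ContDiff ℝ (⊤ : ℕ∞) k := by
  have hdk : deriv k = p := funext fun x => (ho.hasDerivAt x).deriv
  have hdp : deriv p = fun x => -oscForce q (k x) := funext fun x => (ho.hasDerivAt_vel x).deriv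
  have key : ∀ n : ℕ, ContDiff ℝ n k ∧ ContDiff ℝ n p := by
    intro n
    induction n with
    | zero => exact ⟨contDiff_zero.2 ho.continuous, contDiff_zero.2 ho.continuous_vel⟩
    | succ n ih =>
      have hF : ContDiff ℝ n fun x => -oscForce q (k x) :=
        (contDiff_iff_contDiffAt.2 fun x =>
          (contDiffAt_oscForce q (ho.pos x) n).comp x ih.1.contDiffAt).neg
      constructor
      · rw [Nat.cast_succ, contDiff_succ_iff_deriv]
        exact ⟨fun x => (ho.hasDerivAt x).differentiableAt, by simp, hdk ▸ ih.2⟩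
      · rw [Nat.cast_succ, contDiff_succ_iff_deriv]
        exact ⟨fun x => (ho.hasDerivAt_vel x).differentiableAt, by simp, hdp ▸ hF⟩
  exact contDiff_infty.2 fun n => (key n).1

theorem IsOscillation.isCanonicalSolution {q X : ℝ} {k p : ℝ → ℝ}
    (ho : IsOscillation (oscForce q) k p) (hX : X ∈ positivePeriods k) (hp : p 0 = 0) :
    IsCanonicalSolution q (k 0) k where
  smooth := ho.contDiff
  pos := ho.pos
  periodic := ⟨X, hX⟩
  ode x := by
    rw [show deriv k = p from funext fun x => (ho.hasDerivAt x).deriv, (ho.hasDerivAt_vel x).deriv]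
    ring
  init := rfl
  init_deriv := by rw [(ho.hasDerivAt 0).deriv, hp]

theorem IsCanonicalSolution.isOscillation {q α : ℝ} {k : ℝ → ℝ} (hk : IsCanonicalSolution q α k) :
    IsOscillation (oscForce q) k (deriv k) where
  pos := hk.pos
  hasDerivAt x := (hk.smooth.differentiable (by simp) x).hasDerivAt
  hasDerivAt_vel x := by
    have h1 : Differentiable ℝ (deriv k) :=
      (contDiff_infty_iff_deriv.1 hk.smooth).2.differentiable (by simp)
    rw [show -oscForce q (k x) = deriv (deriv k) x by linarith [hk.ode x]]
    exact (h1 x).hasDerivAt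

theorem IsCanonicalSolution.unique {q α : ℝ} {k k' : ℝ → ℝ} (hk : IsCanonicalSolution q α k)
    (hk' : IsCanonicalSolution q α k') : k = k' := by
  obtain ⟨X, hX, hper⟩ := hk.periodic
  obtain ⟨X', hX', hper'⟩ := hk'.periodic
  obtain ⟨a, b, ha, hab⟩ := exists_Icc_of_continuous_periodic hX hk.isOscillation.continuous
    hper hk.pos
  obtain ⟨a', b', ha', hab'⟩ := exists_Icc_of_continuous_periodic hX' hk'.isOscillation.continuous
    hper' hk'.pos
  refine IsOscillation.eq_of_init (a := min a a') (b := max b b') (x₀ := 0)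
    (fun y hy => hasDerivAt_oscForce q hy) (continuousOn_rpow_Ioi _) hk.isOscillation
    hk'.isOscillation (lt_min ha ha') (fun x => Icc_subset_Icc (min_le_left _ _)
    (le_max_left _ _) (hab x)) (fun x => Icc_subset_Icc (min_le_right _ _)
    (le_max_right _ _) (hab' x)) (by rw [hk.init, hk'.init]) (by rw [hk.init_deriv, hk'.init_deriv])

/-- Uniqueness identifies the chosen solution with any explicitly constructed one, whether a
rescaled steady state or an orbit in normal coordinates. -/
theorem kCanon_eq {q α : ℝ} {k : ℝ → ℝ} (hk : IsCanonicalSolution q α k) : kCanon q α = k :=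
  (Classical.epsilon_spec (p := IsCanonicalSolution q α) ⟨k, hk⟩).unique hk

namespace IsOscillation

variable {F h p : ℝ → ℝ} {X : ℝ}

theorem rescale {G : ℝ → ℝ} (ho : IsOscillation F h p) {μ l : ℝ} (hμ : 0 < μ)
    (hG : ∀ y, 0 < y → μ * l ^ 2 * F y = G (μ * y)) :
    IsOscillation G (fun x => μ * h (l * x)) fun x => μ * l * p (l * x) where
  pos x := mul_pos hμ (ho.pos _)
  hasDerivAt x := by
    have := ((ho.hasDerivAt (l * x)).comp x ((hasDerivAt_id x).const_mul l)).const_mul μ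
    convert! this using 1
    ring
  hasDerivAt_vel x := by
    have := ((ho.hasDerivAt_vel (l * x)).comp x ((hasDerivAt_id x).const_mul l)).const_mul (μ * l)
    convert! this using 1
    rw [← hG _ (ho.pos _)]
    ring

theorem integral_force (hF : ContinuousOn F (Ioi 0)) (ho : IsOscillation F h p)
    (hper : Function.Periodic h X) : ∫ x in (0 : ℝ)..X, F (h x) = 0 := by
  have h1 := intervalIntegral.integral_eq_sub_of_hasDerivAt (a := 0) (b := X)
    (fun x _ => ho.hasDerivAt_vel x) ((ho.continuous_comp hF).neg.intervalIntegrable _ _)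
  have hpX := ho.vel_periodic hper 0
  rw [zero_add] at hpX
  rw [intervalIntegral.integral_neg, hpX, sub_self] at h1
  linarith

/-- The force has mean zero over a period and increases through its zero at `1`, so a nonconstant
oscillation cannot stay at or above `1`. -/
theorem apply_zero_lt_one {q : ℝ} (ho : IsOscillation (oscForce q) h p) (hX : 0 < X)
    (hper : Function.Periodic h X) (hmin : ∀ x, h 0 ≤ h x) (hne : ∃ x y, h x ≠ h y) :
    h 0 < 1 := by
  by_contra hcon
  have h1 : ∀ x, 1 ≤ h x := fun x => (not_lt.1 hcon).trans (hmin x)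
  have hne' : ∃ x, h x ≠ 1 := by
    by_contra hall
    push Not at hall
    obtain ⟨x, y, hxy⟩ := hne
    exact hxy (by rw [hall, hall])
  obtain ⟨x, hx⟩ := hne'
  obtain ⟨y, hy, hxy⟩ := hper.exists_mem_Ico₀ hX x
  have hlt : 1 < h y := lt_of_le_of_ne (h1 y) (by rw [← hxy]; exact hx.symm)
  have hpos : 0 < ∫ x in (0 : ℝ)..X, oscForce q (h x) := by
    refine intervalIntegral.integral_pos hX
      (ho.continuous_comp (continuousOn_oscForce q)).continuousOn (fun z _ => ?_)
      ⟨y, Ico_subset_Icc_self hy, ?_⟩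
    · rw [← oscForce_one q]
      exact (strictMonoOn_oscForce q).monotoneOn (mem_Ioi.2 one_pos) (mem_Ioi.2 (ho.pos z)) (h1 z)
    · rw [← oscForce_one q]
      exact strictMonoOn_oscForce q (mem_Ioi.2 one_pos) (mem_Ioi.2 (ho.pos y)) hlt
  rw [ho.integral_force (continuousOn_oscForce q) hper] at hpos
  exact lt_irrefl _ hpos

theorem exists_kCanon_eq {q : ℝ} (ho : IsOscillation F h p) (hX : 0 < X)
    (hper : Function.Periodic h X) (hmin : ∀ x, h 0 ≤ h x) (hne : ∃ x y, h x ≠ h y)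
    {μ l : ℝ} (hμ : 0 < μ) (hl : 0 < l)
    (hG : ∀ y, 0 < y → μ * l ^ 2 * F y = oscForce q (μ * y)) :
    ∃ α ∈ Ioo (0 : ℝ) 1, kCanon q α = fun x => μ * h (l * x) := by
  have hk := ho.rescale hμ hG
  have hkper : X / l ∈ positivePeriods fun x => μ * h (l * x) := by
    refine ⟨div_pos hX hl, fun x => ?_⟩
    simp only
    rw [mul_add, mul_div_cancel₀ _ hl.ne', hper]
  refine ⟨μ * h (l * 0), ⟨hk.pos 0, ?_⟩, kCanon_eq (hk.isCanonicalSolution hkper ?_)⟩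
  · refine hk.apply_zero_lt_one hkper.1 hkper.2 (fun x => ?_) ?_
    · simpa using mul_le_mul_of_nonneg_left (hmin (l * x)) hμ.le
    · obtain ⟨x, y, hxy⟩ := hne
      refine ⟨x / l, y / l, ?_⟩
      simpa [mul_div_cancel₀ _ hl.ne', hμ.ne'] using hxy
  · simp [ho.vel_zero hmin]

end IsOscillation

/-- With amplitude factor `μ` and length factor `l`, the relations `μ l² = 1 / D` and `μ^q = B / D`
are what turns the force `(B y^q - D) / q` into the canonical one. -/
theorem rescale_factor_mul_sq {q B D : ℝ} (hq : q ≠ 0) (hB : 0 < B) (hD : 0 < D) :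
    (B / D) ^ (1 / q) * ((D / B) ^ (1 / (2 * q)) / D ^ (1 / 2 : ℝ)) ^ 2 = 1 / D := by
  have hsq : (D ^ (1 / 2 : ℝ)) ^ 2 = D := by
    rw [← Real.rpow_natCast, ← Real.rpow_mul hD.le]; norm_num
  have hBD : 0 < B / D := div_pos hB hD
  have hDB : 0 < D / B := div_pos hD hB
  rw [div_pow, hsq, ← Real.rpow_natCast ((D / B) ^ (1 / (2 * q))), ← Real.rpow_mul hDB.le,
    show 1 / (2 * q) * ((2 : ℕ) : ℝ) = 1 / q by push_cast; field_simp,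
    mul_div_assoc', ← Real.mul_rpow hBD.le hDB.le, show B / D * (D / B) = 1 by field_simp,
    Real.one_rpow]

theorem rescale_factor_rpow {q B D : ℝ} (hq : q ≠ 0) (hB : 0 < B) (hD : 0 < D) :
    ((B / D) ^ (1 / q)) ^ q = B / D := by
  rw [← Real.rpow_mul (div_pos hB hD).le, one_div_mul_cancel hq, Real.rpow_one]

theorem IsEnergyPotential.exists_deriv_eq {n m q B : ℝ} {H : ℝ → ℝ}
    (hH : IsEnergyPotential (fun y => y ^ n) (fun y => B * y ^ m) H) (hq : q = m - n + 1) :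
    ∃ K, ∀ y, 0 < y → deriv H y = B * oscForce q y + K := by
  refine ⟨deriv H 1, fun y hy => ?_⟩
  have hd : ∀ y ∈ Ioi (0 : ℝ), HasDerivAt (fun y => deriv H y - B * oscForce q y) 0 y :=
    fun y hy => by
      simpa using (hH.hasDerivAt_deriv hq hy).fun_sub ((hasDerivAt_oscForce q hy).const_mul B)
  have := isOpen_Ioi.is_const_of_deriv_eq_zero isPreconnected_Ioi
    (fun y hy => (hd y hy).differentiableAt.differentiableWithinAt)
    (fun y hy => (hd y hy).deriv) (mem_Ioi.2 hy) (mem_Ioi.2 one_pos)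
  simp only [oscForce_one] at this
  linarith

theorem exists_rescalesTo_kCanon {n m q B X : ℝ} (hB : 0 < B) (hq : q = m - n + 1) {H h : ℝ → ℝ}
    (hH : IsEnergyPotential (fun y => y ^ n) (fun y => B * y ^ m) H)
    (hss : IsPositivePeriodicSteadyState (fun y => y ^ n) (fun y => B * y ^ m) X h)
    {x₀ : ℝ} (hx₀ : ∀ x, h x₀ ≤ h x) :
    ∃ α ∈ Ioo (0 : ℝ) 1, RescalesTo q B (fun x => h (x + x₀)) (kCanon q α) := by
  obtain ⟨C, ho'⟩ := hss.exists_isOscillation hH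
  have hX := hss.leastPeriod.1
  have ho := ho'.shift x₀
  have hd1 : deriv (fun x => h (x + x₀)) = fun x => deriv h (x + x₀) :=
    funext fun x => (ho.hasDerivAt x).deriv
  have hd2 : ∀ x, deriv (deriv fun x => h (x + x₀)) x = -(deriv H (h (x + x₀)) - C) := fun x => by
    rw [hd1, (ho.hasDerivAt_vel x).deriv]
  have hper : Function.Periodic (fun x => h (x + x₀)) X := fun x => by
    simp only; rw [show x + X + x₀ = x + x₀ + X by ring, hX.2]
  have hmin : ∀ x, h (0 + x₀) ≤ h (x + x₀) := fun x => by simpa using hx₀ (x + x₀)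
  have hne : ∃ x y, h (x + x₀) ≠ h (y + x₀) := by
    obtain ⟨x, y, hxy⟩ := hss.nonconstant
    exact ⟨x - x₀, y - x₀, by simpa using hxy⟩
  obtain ⟨K, hK⟩ := hH.exists_deriv_eq hq
  by_cases hq0 : q = 0
  · have hlog : ∀ y, 0 < y → deriv H y = B * Real.log y + K := fun y hy => by
      rw [hK y hy, oscForce, if_pos hq0]
    set D := C - K with hD
    have hsq : (B ^ (1 / 2 : ℝ)) ^ 2 = B := by
      rw [← Real.rpow_natCast, ← Real.rpow_mul hB.le]; norm_num
    have hBh : 0 < B ^ (1 / 2 : ℝ) := Real.rpow_pos_of_pos hB _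
    obtain ⟨α, hα, hk⟩ := ho.exists_kCanon_eq (q := q) (μ := Real.exp (-D / B))
      (l := Real.exp (D / (2 * B)) / B ^ (1 / 2 : ℝ)) hX.1 hper hmin hne (Real.exp_pos _)
      (div_pos (Real.exp_pos _) hBh) (fun y hy => by
        rw [oscForce, if_pos hq0, hlog y hy, Real.log_mul (Real.exp_pos _).ne' hy.ne',
          Real.log_exp, div_pow, hsq, ← Real.exp_nat_mul, mul_div_assoc', ← Real.exp_add]
        rw [show -D / B + (2 : ℕ) * (D / (2 * B)) = 0 by push_cast; field_simp; ring,
          Real.exp_zero]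
        rw [hD]
        field_simp
        ring)
    refine ⟨α, hα, Or.inr ⟨hq0, D, fun x => ?_, fun x => ?_⟩⟩
    · rw [hd2, hlog _ (ho'.pos _)]; rw [hD]; ring
    · rw [hk]
      simp only
      congr 3
      ring
  · have hpow : ∀ y, 0 < y → deriv H y - C = (B * y ^ q - (B - q * (K - C))) / q := fun y hy => by
      rw [hK y hy, oscForce, if_neg hq0]
      field_simp
      ring
    set D := B - q * (K - C) with hD
    have hFc : ContinuousOn (fun y => deriv H y - C) (Ioi 0) := fun y hy =>
      ((hH.hasDerivAt_deriv hq hy).sub_const C).continuousAt.continuousWithinAt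
    -- The force has mean zero over a period, so `D` is the mean of `B h^q`.
    have hD0 : 0 < D := by
      have h1 := ho.integral_force hFc hper
      simp only [fun x => hpow _ (ho'.pos (x + x₀))] at h1
      have hc : Continuous fun x => h (x + x₀) ^ q := ho.continuous_comp (continuousOn_rpow_Ioi q)
      rw [intervalIntegral.integral_div, intervalIntegral.integral_sub
        ((hc.const_mul B).intervalIntegrable _ _) (by simp), div_eq_zero_iff,
        or_iff_left hq0, intervalIntegral.integral_const_mul] at h1
      simp only [intervalIntegral.integral_const, smul_eq_mul, sub_zero] at h1
      have h2 : 0 < ∫ x in (0 : ℝ)..X, h (x + x₀) ^ q :=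
        intervalIntegral.intervalIntegral_pos_of_pos (hc.intervalIntegrable _ _)
          (fun x => Real.rpow_pos_of_pos (ho'.pos _) _) hX.1
      have h3 : 0 < X * D := by nlinarith [mul_pos hB h2]
      exact pos_of_mul_pos_right h3 hX.1.le
    have hDh : 0 < D ^ (1 / 2 : ℝ) := Real.rpow_pos_of_pos hD0 _
    have hμ : 0 < (B / D) ^ (1 / q) := Real.rpow_pos_of_pos (div_pos hB hD0) _
    have hl : 0 < (D / B) ^ (1 / (2 * q)) := Real.rpow_pos_of_pos (div_pos hD0 hB) _
    have hscale := rescale_factor_mul_sq hq0 hB hD0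
    have hμq := rescale_factor_rpow hq0 hB hD0
    obtain ⟨α, hα, hk⟩ := ho.exists_kCanon_eq (q := q) hX.1 hper hmin hne hμ (div_pos hl hDh)
      (fun y hy => by
        rw [hscale, oscForce, if_neg hq0, hpow y hy, Real.mul_rpow hμ.le hy.le, hμq]
        field_simp)
    refine ⟨α, hα, Or.inl ⟨hq0, D, hD0, fun x => ?_, fun x => ?_⟩⟩
    · rw [hd2, hpow _ (ho'.pos _)]; ring
    · rw [hk]
      simp only
      congr 3
      ring

/-! ### Normal coordinates for the canonical potential -/

theorem analyticAt_rpow_const {y : ℝ} (hy : 0 < y) (a : ℝ) :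
    AnalyticAt ℝ (fun y : ℝ => y ^ a) y :=
  (Real.contDiffAt_rpow_const_of_ne (n := ⊤) hy.ne').analyticAt

/-- Used twice to divide the potential by `(y - 1)²` without losing analyticity at the minimum, so
that the normal coordinate is regular there. -/
theorem AnalyticAt.dslope_of_analyticAt {f : ℝ → ℝ} {a b : ℝ} (ha : AnalyticAt ℝ f a)
    (hb : AnalyticAt ℝ f b) : AnalyticAt ℝ (dslope f a) b := by
  rcases eq_or_ne b a with rfl | hba
  · obtain ⟨s, hs⟩ := hb
    exact ⟨_, hs.has_fpower_series_dslope_fslope⟩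
  · refine AnalyticAt.congr ?_ (dslope_eventuallyEq_slope_of_ne f hba).symm
    have : slope f a = fun y => (y - a)⁻¹ * (f y - f a) := funext fun y => by
      simp [slope]
    rw [this]
    exact ((analyticAt_id.sub analyticAt_const).inv (sub_ne_zero.2 hba)).mul
      (hb.sub analyticAt_const)

/-- The canonical potential, normalized to vanish at its minimum `1`. -/
noncomputable def canonPot (q y : ℝ) : ℝ :=
  (y ^ (q + 1) / (q + 1) - y) / q + 1 / (q + 1)

/-- The quotient of the canonical potential by `(y - 1) ^ 2`. -/
noncomputable def canonPotQuot (q : ℝ) : ℝ → ℝ :=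
  dslope (dslope (canonPot q) 1) 1

/-- The coordinate in which the canonical potential is harmonic. -/
noncomputable def normalCoord (q y : ℝ) : ℝ :=
  (y - 1) * √(2 * canonPotQuot q y)

/-- The inverse of `normalCoord`. -/
noncomputable def normalInv (q : ℝ) : ℝ → ℝ :=
  Function.invFunOn (normalCoord q) (Ioi 0)

section

variable {q : ℝ}

theorem canonPot_one (hq : 0 < q) : canonPot q 1 = 0 := by
  rw [canonPot, Real.one_rpow]
  field_simp
  ring

theorem hasDerivAt_canonPot (hq : 0 < q) {y : ℝ} (hy : 0 < y) :
    HasDerivAt (canonPot q) (oscForce q y) y := by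
  have h1 := ((((Real.hasDerivAt_rpow_const (p := q + 1) (Or.inl hy.ne')).div_const (q + 1)).sub
    (hasDerivAt_id y)).div_const q).add_const (1 / (q + 1))
  convert! h1 using 1
  rw [oscForce, if_neg hq.ne', add_sub_cancel_right, mul_div_cancel_left₀ _ (by positivity)]

theorem analyticAt_canonPot {y : ℝ} (hy : 0 < y) : AnalyticAt ℝ (canonPot q) y := by
  have h1 := analyticAt_rpow_const hy (q + 1)
  have h2 : AnalyticAt ℝ (fun y : ℝ => (y ^ (q + 1) / (q + 1) - y) / q + 1 / (q + 1)) y := by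
    simp only [div_eq_mul_inv _ (q + 1), div_eq_mul_inv _ q]
    exact (((h1.mul analyticAt_const).sub analyticAt_id).mul analyticAt_const).add analyticAt_const
  exact h2

theorem oscForce_pos {y : ℝ} (hy : 1 < y) : 0 < oscForce q y := by
  rw [← oscForce_one q]
  exact strictMonoOn_oscForce q (mem_Ioi.2 one_pos) (mem_Ioi.2 (one_pos.trans hy)) hy

theorem oscForce_neg {y : ℝ} (hy : 0 < y) (hy1 : y < 1) : oscForce q y < 0 := by
  rw [← oscForce_one q]
  exact strictMonoOn_oscForce q (mem_Ioi.2 hy) (mem_Ioi.2 one_pos) hy1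

theorem canonPot_pos (hq : 0 < q) {y : ℝ} (hy : 0 < y) (hy1 : y ≠ 1) : 0 < canonPot q y := by
  rw [← canonPot_one hq]
  rcases lt_or_gt_of_ne hy1 with h | h
  · have : StrictAntiOn (canonPot q) (Icc y 1) := by
      refine strictAntiOn_of_deriv_neg (convex_Icc _ _) (fun z hz =>
        (hasDerivAt_canonPot hq (hy.trans_le hz.1)).continuousAt.continuousWithinAt) fun z hz => ?_
      rw [interior_Icc] at hz
      rw [(hasDerivAt_canonPot hq (hy.trans hz.1)).deriv]
      exact oscForce_neg (hy.trans hz.1) hz.2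
    exact this (left_mem_Icc.2 h.le) (right_mem_Icc.2 h.le) h
  · have : StrictMonoOn (canonPot q) (Icc 1 y) := by
      refine strictMonoOn_of_deriv_pos (convex_Icc _ _) (fun z hz =>
        (hasDerivAt_canonPot hq (one_pos.trans_le hz.1)).continuousAt.continuousWithinAt)
        fun z hz => ?_
      rw [interior_Icc] at hz
      rw [(hasDerivAt_canonPot hq (one_pos.trans hz.1)).deriv]
      exact oscForce_pos hz.1
    exact this (left_mem_Icc.2 h.le) (right_mem_Icc.2 h.le) h

theorem analyticAt_canonPotQuot {y : ℝ} (hy : 0 < y) : AnalyticAt ℝ (canonPotQuot q) y :=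
  ((analyticAt_canonPot one_pos).dslope_of_analyticAt
    (analyticAt_canonPot one_pos)).dslope_of_analyticAt
    ((analyticAt_canonPot one_pos).dslope_of_analyticAt (analyticAt_canonPot hy))

theorem sq_mul_canonPotQuot (hq : 0 < q) (y : ℝ) :
    (y - 1) ^ 2 * canonPotQuot q y = canonPot q y := by
  have h1 := sub_smul_dslope (canonPot q) 1 y
  have h2 := sub_smul_dslope (dslope (canonPot q) 1) 1 y
  rw [dslope_same, (hasDerivAt_canonPot hq one_pos).deriv, oscForce_one, sub_zero,
    smul_eq_mul] at h2
  rw [canonPot_one hq, sub_zero, smul_eq_mul] at h1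
  rw [canonPotQuot, sq, mul_assoc, h2, h1]

theorem canonPotQuot_one (hq : 0 < q) : canonPotQuot q 1 = 1 / 2 := by
  set W := canonPotQuot q with hW
  have hWa : ∀ y, 0 < y → AnalyticAt ℝ W y := fun y hy => analyticAt_canonPotQuot hy
  -- The first derivative of `U = (y - 1)² W`. A second differentiation at `1` gives `U''(1) = 2
  -- W(1)`, and `U''(1) = 1`.
  have h1 : ∀ y ∈ Ioi (0 : ℝ), oscForce q y = (y - 1) * (2 * W y + (y - 1) * deriv W y) := by
    intro y hy
    have hd := (((hasDerivAt_id y).sub_const 1).pow 2).mul (hWa y hy).differentiableAt.hasDerivAt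
    have he : ((fun y => (id y - 1)) ^ 2 * W) = canonPot q :=
      funext fun y => sq_mul_canonPotQuot hq y
    rw [he] at hd
    rw [(hasDerivAt_canonPot hq hy).unique hd]
    simp
    ring
  have h2 := ((hasDerivAt_id (1 : ℝ)).sub_const 1).mul
    (((hWa 1 one_pos).differentiableAt.hasDerivAt.const_mul 2).add
    (((hasDerivAt_id (1 : ℝ)).sub_const 1).mul
      (hWa 1 one_pos).deriv.differentiableAt.hasDerivAt))
  have h3 := h2.congr_of_eventuallyEq (eventually_of_mem (Ioi_mem_nhds one_pos) h1)
  have h4 := (hasDerivAt_oscForce q one_pos).unique h3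
  simp at h4
  linarith

theorem canonPotQuot_pos (hq : 0 < q) {y : ℝ} (hy : 0 < y) : 0 < canonPotQuot q y := by
  rcases eq_or_ne y 1 with rfl | hy1
  · rw [canonPotQuot_one hq]; norm_num
  · have h1 := canonPot_pos hq hy hy1
    rw [← sq_mul_canonPotQuot hq] at h1
    exact pos_of_mul_pos_right h1 (sq_nonneg _)

theorem normalCoord_one : normalCoord q 1 = 0 := by simp [normalCoord]

theorem analyticAt_normalCoord (hq : 0 < q) {y : ℝ} (hy : 0 < y) :
    AnalyticAt ℝ (normalCoord q) y := by
  have h0 : AnalyticAt ℝ (fun y => 2 * canonPotQuot q y) y :=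
    analyticAt_const.mul (analyticAt_canonPotQuot hy)
  have hp : 2 * canonPotQuot q y ≠ 0 := by
    have := canonPotQuot_pos hq hy
    positivity
  exact (analyticAt_id.sub analyticAt_const).mul
    ((h0.contDiffAt (n := ⊤)).sqrt hp).analyticAt

theorem normalCoord_sq (hq : 0 < q) {y : ℝ} (hy : 0 < y) :
    normalCoord q y ^ 2 / 2 = canonPot q y := by
  have := canonPotQuot_pos hq hy
  rw [normalCoord, mul_pow, Real.sq_sqrt (by positivity), ← sq_mul_canonPotQuot hq]
  ring

theorem normalCoord_mul_deriv (hq : 0 < q) {y : ℝ} (hy : 0 < y) :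
    normalCoord q y * deriv (normalCoord q) y = oscForce q y := by
  have h1 := ((analyticAt_normalCoord hq hy).differentiableAt.hasDerivAt.pow 2).div_const 2
  have h2 := (hasDerivAt_canonPot hq hy).congr_of_eventuallyEq
    (eventually_of_mem (Ioi_mem_nhds hy) fun z hz => normalCoord_sq hq hz)
  have := h1.unique h2
  rw [← this]
  simp
  ring

theorem deriv_normalCoord_one (hq : 0 < q) : deriv (normalCoord q) 1 = 1 := by
  have hp : 2 * canonPotQuot q 1 ≠ 0 := by rw [canonPotQuot_one hq]; norm_num
  have h : AnalyticAt ℝ (fun y => 2 * canonPotQuot q y) 1 :=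
    analyticAt_const.mul (analyticAt_canonPotQuot one_pos)
  have h0 : AnalyticAt ℝ (fun y => √(2 * canonPotQuot q y)) 1 :=
    ((h.contDiffAt (n := ⊤)).sqrt hp).analyticAt
  have h1 := ((hasDerivAt_id (1 : ℝ)).sub_const 1).mul h0.differentiableAt.hasDerivAt
  have h2 : HasDerivAt (normalCoord q) _ 1 := h1
  rw [h2.deriv]
  simp [canonPotQuot_one hq]

theorem normalCoord_neg (hq : 0 < q) {y : ℝ} (hy : 0 < y) (hy1 : y < 1) : normalCoord q y < 0 :=
  mul_neg_of_neg_of_pos (sub_neg.2 hy1) (Real.sqrt_pos.2 (by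
    have := canonPotQuot_pos hq hy; positivity))

theorem normalCoord_pos (hq : 0 < q) {y : ℝ} (hy1 : 1 < y) : 0 < normalCoord q y :=
  mul_pos (sub_pos.2 hy1) (Real.sqrt_pos.2 (by
    have := canonPotQuot_pos hq (one_pos.trans hy1); positivity))

theorem deriv_normalCoord_pos (hq : 0 < q) {y : ℝ} (hy : 0 < y) :
    0 < deriv (normalCoord q) y := by
  have h := normalCoord_mul_deriv hq hy
  rcases lt_trichotomy y 1 with h1 | rfl | h1
  · have h2 := oscForce_neg (q := q) hy h1
    rw [← h] at h2
    exact pos_of_mul_neg_right h2 (normalCoord_neg hq hy h1).le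
  · rw [deriv_normalCoord_one hq]; exact one_pos
  · have h2 := oscForce_pos (q := q) h1
    rw [← h] at h2
    exact pos_of_mul_pos_right h2 (normalCoord_pos hq h1).le

theorem continuousOn_normalCoord (hq : 0 < q) : ContinuousOn (normalCoord q) (Ioi 0) :=
  fun _ hy => (analyticAt_normalCoord hq hy).continuousAt.continuousWithinAt

theorem strictMonoOn_normalCoord (hq : 0 < q) : StrictMonoOn (normalCoord q) (Ioi 0) := by
  refine strictMonoOn_of_deriv_pos (convex_Ioi 0) (continuousOn_normalCoord hq) fun y hy => ?_
  rw [interior_Ioi] at hy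
  exact deriv_normalCoord_pos hq hy

/-- The potential well over `[α, 1]` is matched on the other side of `1`. -/
theorem Icc_subset_image_normalCoord (hq : 0 < q) {α : ℝ} (hα : α ∈ Ioo (0 : ℝ) 1) :
    Icc (normalCoord q α) (-normalCoord q α) ⊆ normalCoord q '' Ioi 0 := by
  -- The point beyond `1` at which the potential regains `1 / (q + 1)`, its value at `0`. Every
  -- level reached at some `α ∈ (0, 1)` is lower.
  set y₁ : ℝ := (q + 1) ^ (1 / q) with hy₁
  have hy₁0 : 0 < y₁ := Real.rpow_pos_of_pos (by linarith) _
  have hy₁1 : 1 < y₁ := Real.one_lt_rpow (by linarith) (by positivity)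
  have hpot : canonPot q y₁ = 1 / (q + 1) := by
    have : y₁ ^ q = q + 1 := by
      rw [hy₁, ← Real.rpow_mul (by linarith), one_div_mul_cancel hq.ne', Real.rpow_one]
    rw [canonPot, Real.rpow_add_one hy₁0.ne', this]
    field_simp
    ring
  have hlt : canonPot q α < 1 / (q + 1) := by
    have h1 : α ^ q < 1 := Real.rpow_lt_one hα.1.le hα.2 hq
    rw [canonPot, Real.rpow_add_one hα.1.ne']
    have : (α ^ q * α / (q + 1) - α) / q < 0 := by
      refine div_neg_of_neg_of_pos ?_ hq
      rw [sub_neg, div_lt_iff₀ (by linarith)]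
      nlinarith [hα.1]
    linarith
  rw [← hpot, ← normalCoord_sq hq hα.1, ← normalCoord_sq hq hy₁0] at hlt
  have hle : -normalCoord q α ≤ normalCoord q y₁ := by
    have := normalCoord_pos hq hy₁1
    nlinarith
  intro t ht
  have hαy : α ≤ y₁ := (hα.2.trans hy₁1).le
  obtain ⟨y, hy, hyt⟩ := intermediate_value_Icc hαy
    ((continuousOn_normalCoord hq).mono fun z hz => hα.1.trans_le hz.1)
    (show t ∈ Icc (normalCoord q α) (normalCoord q y₁) from ⟨ht.1, ht.2.trans hle⟩)
  exact ⟨y, hα.1.trans_le hy.1, hyt⟩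

theorem normalInv_normalCoord (hq : 0 < q) {y : ℝ} (hy : 0 < y) :
    normalInv q (normalCoord q y) = y :=
  (strictMonoOn_normalCoord hq).injOn.leftInvOn_invFunOn hy

theorem analyticAt_normalInv (hq : 0 < q) {y : ℝ} (hy : 0 < y) :
    AnalyticAt ℝ (normalInv q) (normalCoord q y) := by
  refine (analyticAt_comp_iff_of_deriv_ne_zero (analyticAt_normalCoord hq hy)
    (deriv_normalCoord_pos hq hy).ne').1 ?_
  exact analyticAt_id.congr (eventually_of_mem (Ioi_mem_nhds hy) fun z hz =>
    (normalInv_normalCoord hq hz).symm)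

theorem deriv_normalInv_mul (hq : 0 < q) {y : ℝ} (hy : 0 < y) :
    deriv (normalInv q) (normalCoord q y) * deriv (normalCoord q) y = 1 := by
  have h1 := (analyticAt_normalInv hq hy).differentiableAt.hasDerivAt.comp y
    (analyticAt_normalCoord hq hy).differentiableAt.hasDerivAt
  have h2 := (hasDerivAt_id y).congr_of_eventuallyEq
    (eventually_of_mem (Ioi_mem_nhds hy) fun z hz => normalInv_normalCoord hq hz)
  exact h1.unique h2

theorem deriv_normalInv_zero (hq : 0 < q) : deriv (normalInv q) 0 = 1 := by
  have := deriv_normalInv_mul hq one_pos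
  rwa [normalCoord_one, deriv_normalCoord_one hq, mul_one] at this

theorem deriv_normalInv_pos (hq : 0 < q) {t : ℝ} (ht : t ∈ normalCoord q '' Ioi 0) :
    0 < deriv (normalInv q) t := by
  obtain ⟨y, hy, rfl⟩ := ht
  have := deriv_normalInv_mul hq hy
  exact pos_of_mul_pos_left (this ▸ one_pos) (deriv_normalCoord_pos hq hy).le

theorem normalInv_pos (hq : 0 < q) {t : ℝ} (ht : t ∈ normalCoord q '' Ioi 0) :
    0 < normalInv q t := by
  obtain ⟨y, hy, rfl⟩ := ht
  rwa [normalInv_normalCoord hq hy]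

theorem normalCoord_normalInv (hq : 0 < q) {t : ℝ} (ht : t ∈ normalCoord q '' Ioi 0) :
    normalCoord q (normalInv q t) = t := by
  obtain ⟨y, hy, rfl⟩ := ht
  rw [normalInv_normalCoord hq hy]

theorem oscForce_normalInv (hq : 0 < q) {t : ℝ} (ht : t ∈ normalCoord q '' Ioi 0) :
    oscForce q (normalInv q t) * deriv (normalInv q) t = t := by
  obtain ⟨y, hy, rfl⟩ := ht
  rw [normalInv_normalCoord hq hy, ← normalCoord_mul_deriv hq hy, mul_assoc,
    mul_comm (deriv (normalCoord q) y), deriv_normalInv_mul hq hy, mul_one]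

theorem analyticAt_normalInv' (hq : 0 < q) {t : ℝ} (ht : t ∈ normalCoord q '' Ioi 0) :
    AnalyticAt ℝ (normalInv q) t := by
  obtain ⟨y, hy, rfl⟩ := ht
  exact analyticAt_normalInv hq hy

end

/-! ### Orbits as circles: period and action as integrals over the phase -/

/-- The integral of `g (r sin θ)` over a full turn. -/
noncomputable def sinAverage (g : ℝ → ℝ) (r : ℝ) : ℝ :=
  ∫ θ in (-(Real.pi / 2))..(3 * Real.pi / 2), g (r * Real.sin θ)

theorem mul_sin_mem_Icc {r r₁ : ℝ} (hr : |r| ≤ r₁) (θ : ℝ) : r * Real.sin θ ∈ Icc (-r₁) r₁ := by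
  rw [mem_Icc, ← abs_le, abs_mul]
  calc |r| * |Real.sin θ| ≤ |r| * 1 :=
        mul_le_mul_of_nonneg_left (Real.abs_sin_le_one θ) (abs_nonneg r)
    _ ≤ r₁ := by rwa [mul_one]

theorem continuous_comp_mul_sin {g : ℝ → ℝ} {r r₁ : ℝ} (hg : ContinuousOn g (Icc (-r₁) r₁))
    (hr : |r| ≤ r₁) : Continuous fun θ => g (r * Real.sin θ) :=
  hg.comp_continuous (by fun_prop) (mul_sin_mem_Icc hr)

theorem hasDerivAt_sinAverage {g g' : ℝ → ℝ} {r r₁ : ℝ} (hr : |r| < r₁)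
    (hg : ∀ t ∈ Icc (-r₁) r₁, HasDerivAt g (g' t) t) (hg' : ContinuousOn g' (Icc (-r₁) r₁)) :
    HasDerivAt (sinAverage g) (∫ θ in (-(Real.pi / 2))..(3 * Real.pi / 2),
      g' (r * Real.sin θ) * Real.sin θ) r := by
  have hgc : ContinuousOn g (Icc (-r₁) r₁) := fun t ht =>
    (hg t ht).continuousAt.continuousWithinAt
  obtain ⟨C, hC⟩ := isCompact_Icc.exists_bound_of_continuousOn hg'
  have hs : Ioo (-r₁) r₁ ∈ 𝓝 r := Ioo_mem_nhds (abs_lt.1 hr).1 (abs_lt.1 hr).2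
  have hab : ∀ x ∈ Ioo (-r₁) r₁, |x| ≤ r₁ := fun x hx => (abs_lt.2 hx).le
  refine (intervalIntegral.hasDerivAt_integral_of_dominated_loc_of_deriv_le
    (F := fun r θ => g (r * Real.sin θ)) (F' := fun r θ => g' (r * Real.sin θ) * Real.sin θ)
    (bound := fun _ => C) hs ?_ ?_ ?_ ?_ ?_ ?_).2
  · exact eventually_of_mem hs fun x hx =>
      (continuous_comp_mul_sin hgc (hab x hx)).aestronglyMeasurable
  · exact (continuous_comp_mul_sin hgc hr.le).intervalIntegrable _ _
  · exact ((continuous_comp_mul_sin hg' hr.le).mul Real.continuous_sin).aestronglyMeasurable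
  · refine Eventually.of_forall fun θ _ x hx => ?_
    rw [norm_mul]
    have h1 := hC _ (mul_sin_mem_Icc (hab x hx) θ)
    calc _ ≤ ‖g' (x * Real.sin θ)‖ * 1 :=
          mul_le_mul_of_nonneg_left (Real.abs_sin_le_one θ) (norm_nonneg _)
      _ ≤ C := by rwa [mul_one]
  · simp
  · refine Eventually.of_forall fun θ _ x hx => ?_
    have := (hg _ (mul_sin_mem_Icc (hab x hx) θ)).comp x
      ((hasDerivAt_id x).mul_const (Real.sin θ))
    simpa using! this

/-- An increasing phase function with positive periodic speed has an increasing inverse. -/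
theorem exists_inverse_phase {v : ℝ → ℝ} (hv : Continuous v) (hpos : ∀ θ, 0 < v θ) {T : ℝ}
    (hT : 0 < T) (hper : Function.Periodic v T) (a : ℝ) :
    ∃ φ : ℝ → ℝ, (∀ θ, φ (∫ s in a..θ, v s) = θ) ∧ (∀ t, ∫ s in a..φ t, v s = t) ∧
      StrictMono φ ∧ (∀ t, HasDerivAt φ (v (φ t))⁻¹ t) ∧
      ∀ t, φ (t + ∫ s in a..(a + T), v s) = φ t + T := by
  set τ : ℝ → ℝ := fun θ => ∫ s in a..θ, v s with hτ
  have hτd : ∀ θ, HasDerivAt τ (v θ) θ := fun θ => (hv.integral_hasStrictDerivAt a θ).hasDerivAt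
  have hτc : Continuous τ := continuous_iff_continuousAt.2 fun θ => (hτd θ).continuousAt
  have hmono : StrictMono τ := strictMono_of_deriv_pos fun θ => by
    rw [(hτd θ).deriv]; exact hpos θ
  obtain ⟨c, b, hc, hcb⟩ := exists_Icc_of_continuous_periodic hT hv hper hpos
  have hmono' : Monotone fun θ => τ θ - c * θ := by
    have hd : ∀ θ, HasDerivAt (fun θ => τ θ - c * θ) (v θ - c) θ := fun θ => by
      simpa using (hτd θ).fun_sub ((hasDerivAt_id θ).const_mul c)
    refine monotone_of_deriv_nonneg (fun θ => (hd θ).differentiableAt) fun θ => ?_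
    rw [(hd θ).deriv]
    exact sub_nonneg.2 (hcb θ).1
  have htop : Tendsto τ atTop atTop := by
    have h1 : Tendsto (fun θ => c * θ + (τ 0 - c * 0)) atTop atTop :=
      tendsto_atTop_add_const_right _ _ (tendsto_id.const_mul_atTop hc)
    refine tendsto_atTop_mono' _ ?_ h1
    filter_upwards [eventually_ge_atTop 0] with θ hθ
    have := hmono' hθ
    simp only at this
    linarith
  have hbot : Tendsto τ atBot atBot := by
    have h1 : Tendsto (fun θ => c * θ + (τ 0 - c * 0)) atBot atBot :=
      tendsto_atBot_add_const_right _ _ (tendsto_id.const_mul_atBot hc)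
    refine tendsto_atBot_mono' _ ?_ h1
    filter_upwards [eventually_le_atBot 0] with θ hθ
    have := hmono' hθ
    simp only at this
    linarith
  set e := hmono.orderIsoOfSurjective τ (hτc.surjective htop hbot) with he
  have hl : ∀ θ, e.symm (τ θ) = θ := fun θ => e.symm_apply_apply θ
  have hr : ∀ t, τ (e.symm t) = t := fun t => e.apply_symm_apply t
  refine ⟨e.symm, hl, hr, e.symm.strictMono, fun t => ?_, fun t => ?_⟩
  · exact HasDerivAt.of_local_left_inverse e.symm.continuous.continuousAt (hτd _) (hpos _).ne'
      (Eventually.of_forall hr)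
  · apply hmono.injective
    rw [hr]
    change _ = ∫ s in a..(e.symm t + T), v s
    rw [← intervalIntegral.integral_add_adjacent_intervals (hv.intervalIntegrable a (e.symm t))
      (hv.intervalIntegrable _ (e.symm t + T)), hper.intervalIntegral_add_eq (e.symm t) a]
    congr 1
    exact (hr t).symm

section

variable {q α : ℝ}

theorem continuousOn_normalInv (hq : 0 < q) :
    ContinuousOn (normalInv q) (normalCoord q '' Ioi 0) := fun _ ht =>
  (analyticAt_normalInv' hq ht).continuousAt.continuousWithinAt

theorem continuousOn_deriv_normalInv (hq : 0 < q) :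
    ContinuousOn (deriv (normalInv q)) (normalCoord q '' Ioi 0) := fun _ ht =>
  (analyticAt_normalInv' hq ht).deriv.continuousAt.continuousWithinAt

theorem Icc_neg_subset_image_normalCoord (hq : 0 < q) (hα : α ∈ Ioo (0 : ℝ) 1) :
    Icc (-(-normalCoord q α)) (-normalCoord q α) ⊆ normalCoord q '' Ioi 0 := by
  rw [neg_neg]; exact Icc_subset_image_normalCoord hq hα

/-- The canonical solution in normal coordinates: existence, least period and action. -/
theorem exists_canonical (hq : 0 < q) (hα : α ∈ Ioo (0 : ℝ) 1) :
    ∃ p : ℝ → ℝ, IsOscillation (oscForce q) (kCanon q α) p ∧ kCanon q α 0 = α ∧ p 0 = 0 ∧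
      IsLeast (positivePeriods (kCanon q α))
        (sinAverage (deriv (normalInv q)) (-normalCoord q α)) ∧
      periodMap q α = sinAverage (deriv (normalInv q)) (-normalCoord q α) ∧
      ∫ x in (0 : ℝ)..periodMap q α, p x ^ 2 =
        sinAverage (fun t => t * normalInv q t) (-normalCoord q α) := by
  set Y := normalInv q with hY
  set r := -normalCoord q α with hr
  have hr0 : 0 < r := neg_pos.2 (normalCoord_neg hq hα.1 hα.2)
  have hsub : Icc (-r) r ⊆ normalCoord q '' Ioi 0 := Icc_neg_subset_image_normalCoord hq hα
  have habs : |r| ≤ r := (abs_of_pos hr0).le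
  have hmem : ∀ θ, r * Real.sin θ ∈ normalCoord q '' Ioi 0 := fun θ =>
    hsub (mul_sin_mem_Icc habs θ)
  -- In normal coordinates the energy level is the circle `t = r sin θ`, `p = r cos θ`, traversed
  -- with `dx/dθ = Y'(r sin θ)`. The phase starts at `-π/2`, where `t = -r` and the solution is at
  -- its minimum `α`.
  set v : ℝ → ℝ := fun θ => deriv Y (r * Real.sin θ) with hv
  have hvc : Continuous v :=
    continuous_comp_mul_sin ((continuousOn_deriv_normalInv hq).mono hsub) habs
  have hYc : Continuous fun θ => Y (r * Real.sin θ) :=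
    continuous_comp_mul_sin ((continuousOn_normalInv hq).mono hsub) habs
  have hvpos : ∀ θ, 0 < v θ := fun θ => deriv_normalInv_pos hq (hmem θ)
  have hvper : Function.Periodic v (2 * Real.pi) := fun θ => by
    simp only [hv, Real.sin_add_two_pi]
  have hYd : ∀ θ, HasDerivAt (fun θ => Y (r * Real.sin θ)) (v θ * (r * Real.cos θ)) θ := fun θ =>
    (analyticAt_normalInv' hq (hmem θ)).differentiableAt.hasDerivAt.comp θ
      ((Real.hasDerivAt_sin θ).const_mul r)
  obtain ⟨φ, hφl, hφr, hφmono, hφd, hφper⟩ :=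
    exists_inverse_phase hvc hvpos Real.two_pi_pos hvper (-(Real.pi / 2))
  rw [show -(Real.pi / 2) + 2 * Real.pi = 3 * Real.pi / 2 by ring] at hφper
  set P := ∫ s in (-(Real.pi / 2))..(3 * Real.pi / 2), v s with hP
  have hP0 : 0 < P := intervalIntegral.intervalIntegral_pos_of_pos (hvc.intervalIntegrable _ _)
    hvpos (by linarith [Real.pi_pos])
  have hφ0 : φ 0 = -(Real.pi / 2) := by
    have := hφl (-(Real.pi / 2))
    rwa [intervalIntegral.integral_same] at this
  have hφP : φ P = 3 * Real.pi / 2 := hφl _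
  set k : ℝ → ℝ := fun t => Y (r * Real.sin (φ t)) with hk
  set p : ℝ → ℝ := fun t => r * Real.cos (φ t) with hp
  have ho : IsOscillation (oscForce q) k p := by
    refine ⟨fun t => normalInv_pos hq (hmem _), fun t => ?_, fun t => ?_⟩
    · have := (hYd (φ t)).comp t (hφd t)
      convert! this using 1
      have := (hvpos (φ t)).ne'
      field_simp
      rfl
    · have := ((hφd t).cos).const_mul r
      convert! this using 1
      have h1 := oscForce_normalInv hq (hmem (φ t))
      have h2 : v (φ t) ≠ 0 := (hvpos (φ t)).ne'
      change oscForce q (k t) * v (φ t) = r * Real.sin (φ t) at h1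
      field_simp
      linarith
  have hkper : Function.Periodic k P := fun t => by
    simp only [hk, hφper, Real.sin_add_two_pi]
  have hk0 : k 0 = α := by
    simp only [hk]
    rw [hφ0, Real.sin_neg, Real.sin_pi_div_two, mul_neg_one, hr, neg_neg, hY,
      normalInv_normalCoord hq hα.1]
  have hp0 : p 0 = 0 := by
    simp only [hp]
    rw [hφ0, Real.cos_neg, Real.cos_pi_div_two, mul_zero]
  have hcan : IsCanonicalSolution q α k := by
    have := ho.isCanonicalSolution ⟨hP0, hkper⟩ hp0
    rwa [hk0] at this
  -- A shorter period would return to `α` and force `sin (φ T) = -1` at a phase strictly between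
  -- `-π/2` and `3π/2`.
  have hleast : IsLeast (positivePeriods k) P := by
    refine ⟨⟨hP0, hkper⟩, fun T hT => ?_⟩
    by_contra hlt
    push Not at hlt
    have h1 : k T = k 0 := by simpa using hT.2 0
    rw [hk0] at h1
    have h2 : r * Real.sin (φ T) = normalCoord q α := by
      rw [← h1]; exact (normalCoord_normalInv hq (hmem _)).symm
    have h3 : Real.sin (φ T) = -1 := by
      rw [show normalCoord q α = r * -1 by rw [hr]; ring] at h2
      exact mul_left_cancel₀ hr0.ne' h2
    obtain ⟨j, hj⟩ := Real.sin_eq_neg_one_iff.1 h3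
    have a1 := hφmono hT.1
    have a2 := hφmono hlt
    rw [hφ0, ← hj] at a1
    rw [hφP, ← hj] at a2
    have b1 : (0 : ℝ) < j := by
      by_contra hcon
      nlinarith [Real.pi_pos, not_lt.1 hcon]
    have b2 : (j : ℝ) < 1 := by
      by_contra hcon
      nlinarith [Real.pi_pos, not_lt.1 hcon]
    have c1 : 0 < j := by exact_mod_cast b1
    have c2 : j < 1 := by exact_mod_cast b2
    omega
  have hperiod : periodMap q α = P := by
    rw [periodMap, kCanon_eq hcan]; exact hleast.csInf_eq
  have hcov : ∫ x in (0 : ℝ)..P, p x ^ 2 = ∫ θ in (-(Real.pi / 2))..(3 * Real.pi / 2),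
      p (∫ s in (-(Real.pi / 2))..θ, v s) ^ 2 * v θ := by
    have := intervalIntegral.integral_comp_mul_deriv (a := -(Real.pi / 2)) (b := 3 * Real.pi / 2)
      (f := fun θ => ∫ s in (-(Real.pi / 2))..θ, v s) (f' := v) (g := fun x => p x ^ 2)
      (fun θ _ => (hvc.integral_hasStrictDerivAt _ θ).hasDerivAt) hvc.continuousOn
      (ho.continuous_vel.pow 2)
    rw [intervalIntegral.integral_same] at this
    exact this.symm
  rw [hperiod, kCanon_eq hcan]
  refine ⟨p, ho, hk0, hp0, hleast, rfl, ?_⟩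
  rw [hcov]
  simp only [hp, hφl, sinAverage]
  -- Integration by parts in the phase turns `∫ (r cos θ)² Y'(r sin θ)` into `∫ r sin θ Y(r sin θ)`;
  -- the cosine vanishes at both ends.
  have hder : ∀ θ ∈ uIcc (-(Real.pi / 2)) (3 * Real.pi / 2),
      HasDerivAt (fun θ => r * Real.cos θ * Y (r * Real.sin θ))
      ((r * Real.cos θ) ^ 2 * v θ - r * Real.sin θ * Y (r * Real.sin θ)) θ := fun θ _ => by
    convert! ((Real.hasDerivAt_cos θ).const_mul r).mul (hYd θ) using 1
    ring
  have hc1 : Continuous fun θ => (r * Real.cos θ) ^ 2 * v θ := by fun_prop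
  have hc2 : Continuous fun θ => r * Real.sin θ * Y (r * Real.sin θ) :=
    (by fun_prop : Continuous fun θ => r * Real.sin θ).mul hYc
  have := intervalIntegral.integral_eq_sub_of_hasDerivAt hder
    ((hc1.sub hc2).intervalIntegrable _ _)
  rw [intervalIntegral.integral_sub (hc1.intervalIntegrable _ _) (hc2.intervalIntegrable _ _),
    Real.cos_neg, Real.cos_pi_div_two,
    show 3 * Real.pi / 2 = Real.pi / 2 + Real.pi by ring, Real.cos_add_pi,
    Real.cos_pi_div_two] at this
  rw [show 3 * Real.pi / 2 = Real.pi / 2 + Real.pi by ring]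
  simp only [mul_zero, neg_zero, zero_mul, sub_self] at this
  linarith

end

/-! ### The normalized energy gap along the canonical family -/

section

variable {q α : ℝ}

/-- The period of the canonical solution, extended up to `α = 1`. -/
noncomputable def canonPeriod (q α : ℝ) : ℝ :=
  sinAverage (deriv (normalInv q)) (-normalCoord q α)

/-- The action `∫ k'²` of the canonical solution, extended up to `α = 1`. -/
noncomputable def canonAction (q α : ℝ) : ℝ :=
  sinAverage (fun t => t * normalInv q t) (-normalCoord q α)

/-- The area below the canonical solution, extended up to `α = 1`. -/
noncomputable def canonArea (q α : ℝ) : ℝ :=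
  (q + 3) / 2 * canonAction q α - (q + 1) * (canonPeriod q α * canonPot q α) + canonPeriod q α

/-- The scale invariant bifurcation parameter, extended up to `α = 1`. -/
noncomputable def canonBif (q α : ℝ) : ℝ :=
  canonPeriod q α ^ (3 - q) * canonArea q α ^ (q - 1)

/-- The energy excess of the canonical solution over its mean, normalized to unit period and
area. -/
noncomputable def canonGap (q α : ℝ) : ℝ :=
  (q - 1) / (2 * (q + 1)) * (canonPeriod q α ^ 3 / canonArea q α ^ 2 * canonAction q α)
    - 1 / (q * (q + 1)) * (canonPeriod q α ^ 3 / canonArea q α)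
    + 1 / (q * (q + 1)) * canonBif q α

theorem sinAverage_zero (g : ℝ → ℝ) : sinAverage g 0 = 2 * Real.pi * g 0 := by
  simp only [sinAverage, zero_mul, intervalIntegral.integral_const, smul_eq_mul]
  ring

theorem canonPeriod_one (hq : 0 < q) : canonPeriod q 1 = 2 * Real.pi := by
  rw [canonPeriod, normalCoord_one, neg_zero, sinAverage_zero, deriv_normalInv_zero hq, mul_one]

theorem canonAction_one : canonAction q 1 = 0 := by
  rw [canonAction, normalCoord_one, neg_zero, sinAverage_zero, zero_mul, mul_zero]

theorem canonArea_one (hq : 0 < q) : canonArea q 1 = 2 * Real.pi := by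
  rw [canonArea, canonAction_one, canonPot_one hq, canonPeriod_one hq]
  ring

theorem canonGap_one (hq : 0 < q) : canonGap q 1 = 0 := by
  have hπ : 0 < 2 * Real.pi := Real.two_pi_pos
  rw [canonGap, canonBif, canonAction_one, canonArea_one hq, canonPeriod_one hq,
    ← Real.rpow_add hπ, show 3 - q + (q - 1) = ((2 : ℕ) : ℝ) by push_cast; ring,
    Real.rpow_natCast]
  field_simp
  ring

/-- Each `α ∈ (0, 1]` lies above some `δ` whose well contains that of `α` in its interior. -/
theorem exists_larger_well (hq : 0 < q) (hα : α ∈ Ioc (0 : ℝ) 1) :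
    ∃ r₁, |(-normalCoord q α)| < r₁ ∧ Icc (-r₁) r₁ ⊆ normalCoord q '' Ioi 0 := by
  have hδ : α / 2 ∈ Ioo (0 : ℝ) 1 := ⟨by linarith [hα.1], by linarith [hα.2]⟩
  refine ⟨-normalCoord q (α / 2), ?_, Icc_neg_subset_image_normalCoord hq hδ⟩
  have h1 := strictMonoOn_normalCoord hq (mem_Ioi.2 hδ.1) (mem_Ioi.2 hα.1) (by linarith [hα.1])
  have h2 := (strictMonoOn_normalCoord hq).monotoneOn (mem_Ioi.2 hα.1) (mem_Ioi.2 one_pos) hα.2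
  rw [normalCoord_one] at h2
  rw [abs_neg, abs_of_nonpos h2]
  linarith

theorem hasDerivAt_neg_normalCoord (hq : 0 < q) (hα : 0 < α) :
    HasDerivAt (fun β => -normalCoord q β) (-deriv (normalCoord q) α) α :=
  (analyticAt_normalCoord hq hα).differentiableAt.hasDerivAt.neg

theorem differentiableAt_canonPeriod (hq : 0 < q) (hα : α ∈ Ioc (0 : ℝ) 1) :
    DifferentiableAt ℝ (canonPeriod q) α := by
  obtain ⟨r₁, hr₁, hsub⟩ := exists_larger_well hq hα
  have h1 := hasDerivAt_sinAverage (g := deriv (normalInv q)) (g' := deriv (deriv (normalInv q)))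
    hr₁ (fun t ht => (analyticAt_normalInv' hq (hsub ht)).deriv.differentiableAt.hasDerivAt)
    fun t ht => (analyticAt_normalInv' hq (hsub ht)).deriv.deriv.continuousAt.continuousWithinAt
  exact (h1.comp α (hasDerivAt_neg_normalCoord hq hα.1)).differentiableAt

/-- The classical relation between action and period: the action differentiated in the energy level
`U(α)` is the period, and `U'(α)` is the force. -/
theorem hasDerivAt_canonAction (hq : 0 < q) (hα : α ∈ Ioc (0 : ℝ) 1) :
    HasDerivAt (canonAction q) (oscForce q α * canonPeriod q α) α := by
  obtain ⟨r₁, hr₁, hsub⟩ := exists_larger_well hq hα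
  set r := -normalCoord q α with hr
  set Y := normalInv q with hY
  have hYd : ∀ t ∈ Icc (-r₁) r₁, HasDerivAt Y (deriv Y t) t := fun t ht =>
    (analyticAt_normalInv' hq (hsub ht)).differentiableAt.hasDerivAt
  have hYc := (continuousOn_normalInv hq).mono hsub
  have hY'c := (continuousOn_deriv_normalInv hq).mono hsub
  have h1 := hasDerivAt_sinAverage (g := fun t => t * Y t) (g' := fun t => 1 * Y t + t * deriv Y t)
    hr₁ (fun t ht => (hasDerivAt_id t).mul (hYd t ht))
    ((continuousOn_const.mul hYc).add (continuousOn_id.mul hY'c))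
  have hc : Continuous fun θ => Y (r * Real.sin θ) := continuous_comp_mul_sin hYc hr₁.le
  have hc' : Continuous fun θ => deriv Y (r * Real.sin θ) := continuous_comp_mul_sin hY'c hr₁.le
  have hder : ∀ θ ∈ uIcc (-(Real.pi / 2)) (3 * Real.pi / 2),
      HasDerivAt (fun θ => -Real.cos θ * Y (r * Real.sin θ))
      ((1 * Y (r * Real.sin θ) + r * Real.sin θ * deriv Y (r * Real.sin θ)) * Real.sin θ
        - r * deriv Y (r * Real.sin θ)) θ := fun θ _ => by
    have e1 := (hYd _ (mul_sin_mem_Icc hr₁.le θ)).comp θ ((Real.hasDerivAt_sin θ).const_mul r)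
    convert! (Real.hasDerivAt_cos θ).neg.mul e1 using 1
    have := Real.sin_sq_add_cos_sq θ
    simp only [Pi.neg_apply, Function.comp]
    linear_combination r * deriv Y (r * Real.sin θ) * this
  have hc1 : Continuous fun θ =>
      (1 * Y (r * Real.sin θ) + r * Real.sin θ * deriv Y (r * Real.sin θ)) * Real.sin θ :=
    ((continuous_const.mul hc).add ((continuous_const.mul Real.continuous_sin).mul hc')).mul
      Real.continuous_sin
  have hc2 : Continuous fun θ => r * deriv Y (r * Real.sin θ) := continuous_const.mul hc'
  have h2 := intervalIntegral.integral_eq_sub_of_hasDerivAt hder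
    ((hc1.sub hc2).intervalIntegrable _ _)
  rw [intervalIntegral.integral_sub (hc1.intervalIntegrable _ _) (hc2.intervalIntegrable _ _),
    intervalIntegral.integral_const_mul] at h2
  have e1 : Real.cos (3 * Real.pi / 2) = 0 := by
    rw [show 3 * Real.pi / 2 = Real.pi / 2 + Real.pi by ring, Real.cos_add_pi,
      Real.cos_pi_div_two, neg_zero]
  rw [e1, Real.cos_neg, Real.cos_pi_div_two, neg_zero, zero_mul, zero_mul, sub_self] at h2
  have h3 := h1.comp α (hasDerivAt_neg_normalCoord hq hα.1)
  convert! h3 using 1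
  rw [sub_eq_zero.1 h2, ← normalCoord_mul_deriv hq hα.1]
  change _ * canonPeriod q α = r * canonPeriod q α * _
  rw [hr]
  ring

theorem differentiableAt_canonArea (hq : 0 < q) (hα : α ∈ Ioc (0 : ℝ) 1) :
    DifferentiableAt ℝ (canonArea q) α :=
  (((hasDerivAt_canonAction hq hα).differentiableAt.const_mul _).sub
    (((differentiableAt_canonPeriod hq hα).mul
      (hasDerivAt_canonPot hq hα.1).differentiableAt).const_mul _)).add
    (differentiableAt_canonPeriod hq hα)

theorem deriv_canonArea (hq : 0 < q) (hα : α ∈ Ioc (0 : ℝ) 1) :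
    deriv (canonArea q) α = (q + 3) / 2 * (oscForce q α * canonPeriod q α)
      - (q + 1) * (deriv (canonPeriod q) α * canonPot q α + canonPeriod q α * oscForce q α)
      + deriv (canonPeriod q) α := by
  have hP := (differentiableAt_canonPeriod hq hα).hasDerivAt
  have : HasDerivAt (canonArea q) _ α :=
    (((hasDerivAt_canonAction hq hα).const_mul ((q + 3) / 2)).sub
    ((hP.mul (hasDerivAt_canonPot hq hα.1)).const_mul (q + 1))).add hP
  exact this.deriv

/-- The area formula and the strict Jensen inequality for the canonical solution. -/
theorem canonical_integrals (hq : 0 < q) (hα : α ∈ Ioo (0 : ℝ) 1) :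
    periodMap q α = canonPeriod q α ∧ areaMap q α = canonArea q α ∧
      0 < canonPeriod q α ∧ 0 < canonArea q α ∧
      IsLeast (positivePeriods (kCanon q α)) (canonPeriod q α) ∧
      ∫ x in (0 : ℝ)..canonPeriod q α, deriv (kCanon q α) x ^ 2 = canonAction q α ∧
      ∫ x in (0 : ℝ)..canonPeriod q α, kCanon q α x ^ (q + 1) =
        q * canonAction q α + canonArea q α ∧
      canonPeriod q α * (canonArea q α / canonPeriod q α) ^ (q + 1) <
        q * canonAction q α + canonArea q α := by
  obtain ⟨p, ho, hk0, hp0, hleast, hP, hI⟩ := exists_canonical hq hα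
  set k := kCanon q α with hk
  change periodMap q α = canonPeriod q α at hP
  have hdk : deriv k = p := funext fun x => (ho.hasDerivAt x).deriv
  change IsLeast _ (canonPeriod q α) at hleast
  change _ = canonAction q α at hI
  have hA' : areaMap q α = ∫ x in (0 : ℝ)..canonPeriod q α, k x := by rw [areaMap, hP]
  rw [hP] at hI ⊢
  rw [hdk]
  set P := canonPeriod q α with hPdef
  set I := canonAction q α with hIdef
  have hP0 : 0 < P := hleast.1.1
  have hkc := ho.continuous
  have hpc := ho.continuous_vel
  have hkq : Continuous fun x => k x ^ (q + 1) := ho.continuous_comp (continuousOn_rpow_Ioi _)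
  set A := ∫ x in (0 : ℝ)..P, k x with hA
  set M := ∫ x in (0 : ℝ)..P, k x ^ (q + 1) with hM
  have hA0 : 0 < A :=
    intervalIntegral.intervalIntegral_pos_of_pos (hkc.intervalIntegrable _ _) ho.pos hP0
  have e1 : I = (M - A) / q := by
    have h1 := ho.integral_force_mul (continuousOn_oscForce q) hleast.1.2 0
    rw [hI] at h1
    rw [← h1, hM, hA, ← intervalIntegral.integral_sub (hkq.intervalIntegrable _ _)
      (hkc.intervalIntegrable _ _), ← intervalIntegral.integral_div]
    refine intervalIntegral.integral_congr fun x _ => ?_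
    rw [oscForce, if_neg hq.ne', Real.rpow_add_one (ho.pos x).ne']
    ring
  -- `e1` comes from multiplying the equation by `k`, this identity from averaging the conserved
  -- energy. Eliminating `M` expresses the area through period and action, which is the formula
  -- defining `canonArea`.
  have e2 : 1 / 2 * I + ((M / (q + 1) - A) / q + P * (1 / (q + 1))) = P * canonPot q α := by
    have h1 : ∫ x in (0 : ℝ)..P, (1 / 2 * p x ^ 2 + ((k x ^ (q + 1) / (q + 1) - k x) / q
        + 1 / (q + 1))) = P * canonPot q α := by
      have : ∀ x, 1 / 2 * p x ^ 2 + ((k x ^ (q + 1) / (q + 1) - k x) / q + 1 / (q + 1)) =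
          canonPot q α := fun x => by
        have := ho.energy_eq (V := canonPot q) (fun y hy => hasDerivAt_canonPot hq hy) x 0
        rw [hp0, hk0] at this
        rw [canonPot] at this
        linarith
      simp only [this]
      simp
    rw [← h1, intervalIntegral.integral_add, intervalIntegral.integral_add,
      intervalIntegral.integral_div, intervalIntegral.integral_sub, intervalIntegral.integral_div,
      intervalIntegral.integral_const_mul, hI, ← hA, ← hM]
    · simp
    all_goals exact Continuous.intervalIntegrable (by fun_prop) _ _
  have hMI : M = q * I + A := by rw [e1]; field_simp; ring
  have hAform : A = canonArea q α := by
    rw [canonArea, ← hPdef, ← hIdef]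
    rw [hMI] at e2
    field_simp at e2 ⊢
    refine mul_left_cancel₀ hq.ne' ?_
    linear_combination -e2
  rw [hA', ← hAform, ← hMI]
  refine ⟨rfl, rfl, hP0, hA0, hleast, hI, rfl, ?_⟩
  set c := A / P with hc
  have hc0 : 0 < c := div_pos hA0 hP0
  have hcA : c * P = A := by rw [hc]; field_simp
  -- Jensen's inequality for `z^(q+1)` by its tangent at the mean `c`, whose linear term integrates
  -- to zero.
  have hstrict : ∀ z, 0 < z → z ≠ c → c ^ (q + 1) + (q + 1) * c ^ q * (z - c) < z ^ (q + 1) := by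
    intro z hz hzc
    have h1 := one_add_mul_self_lt_rpow_one_add (s := z / c - 1) (p := q + 1)
      (by have := div_pos hz hc0; linarith)
      (by rw [sub_ne_zero]; intro h; exact hzc (by field_simp at h; exact h)) (by linarith)
    rw [add_sub_cancel, Real.div_rpow hz.le hc0.le, lt_div_iff₀ (Real.rpow_pos_of_pos hc0 _),
      Real.rpow_add_one hc0.ne'] at h1
    rw [Real.rpow_add_one hc0.ne']
    calc _ = (1 + (q + 1) * (z / c - 1)) * (c ^ q * c) := by field_simp
      _ < _ := h1
  have hex : ∃ x ∈ Icc 0 P, k x ≠ c := by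
    by_contra hcon
    push Not at hcon
    have hconst : ∀ x, k x = c := fun x => by
      obtain ⟨y, hy, hxy⟩ := hleast.1.2.exists_mem_Ico₀ hP0 x
      rw [hxy]; exact hcon y (Ico_subset_Icc_self hy)
    have h1 := ho.integral_force (continuousOn_oscForce q) hleast.1.2
    have hcα : c = α := by rw [← hk0, hconst]
    simp only [hconst] at h1
    rw [intervalIntegral.integral_const, smul_eq_mul, sub_zero, hcα] at h1
    exact absurd h1 (mul_neg_of_pos_of_neg hP0 (oscForce_neg hα.1 hα.2)).ne
  obtain ⟨x₁, hx₁, hne⟩ := hex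
  have hlt : ∫ x in (0 : ℝ)..P, (c ^ (q + 1) + (q + 1) * c ^ q * (k x - c)) < M := by
    refine intervalIntegral.integral_lt_integral_of_continuousOn_of_le_of_exists_lt hP0
      (by fun_prop) hkq.continuousOn (fun x _ => ?_) ⟨x₁, hx₁, hstrict _ (ho.pos _) hne⟩
    by_cases hx : k x = c
    · rw [hx]; simp
    · exact (hstrict _ (ho.pos x) hx).le
  rw [intervalIntegral.integral_add (by simp) (Continuous.intervalIntegrable (by fun_prop) _ _),
    intervalIntegral.integral_const_mul, intervalIntegral.integral_sub
    (hkc.intervalIntegrable _ _) (by simp)] at hlt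
  simp only [intervalIntegral.integral_const, smul_eq_mul, sub_zero] at hlt
  rw [← hA] at hlt
  have hz : A - P * c = 0 := by linarith
  rw [hz, mul_zero, add_zero] at hlt
  exact hlt

theorem hasDerivAt_canonBif (hq : 0 < q) (hα : α ∈ Ioc (0 : ℝ) 1) (hP : 0 < canonPeriod q α)
    (hA : 0 < canonArea q α) :
    HasDerivAt (canonBif q) (canonBif q α * ((3 - q) * (deriv (canonPeriod q) α / canonPeriod q α)
      + (q - 1) * (deriv (canonArea q) α / canonArea q α))) α := by
  have h1 := (differentiableAt_canonPeriod hq hα).hasDerivAt.rpow_const (p := 3 - q)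
    (Or.inl hP.ne')
  have h2 := (differentiableAt_canonArea hq hα).hasDerivAt.rpow_const (p := q - 1)
    (Or.inl hA.ne')
  convert! h1.mul h2 using 1
  rw [Real.rpow_sub_one hP.ne' (3 - q), Real.rpow_sub_one hA.ne' (q - 1), canonBif]
  generalize canonPeriod q α ^ (3 - q) = x
  generalize canonArea q α ^ (q - 1) = y
  field_simp

/-- The rate of change of the normalized energy gap is a negative multiple of that of the
bifurcation parameter. -/
theorem hasDerivAt_canonGap (hq : 0 < q) (hα : α ∈ Ioc (0 : ℝ) 1) (hP : 0 < canonPeriod q α)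
    (hA : 0 < canonArea q α) :
    HasDerivAt (canonGap q) (-(1 / (q * (q + 1)) * (canonPeriod q α ^ q
      * canonArea q α ^ (-(q + 1)) * (q * canonAction q α + canonArea q α) - 1)
      * deriv (canonBif q) α)) α := by
  -- For `u(x) = (P/A) k(P x)` the bracketed factor in the derivative is `∫ u^(q+1) - 1` over the
  -- unit period. The envelope argument predicts the formula; here it follows algebraically from the
  -- derivative of the action and the area formula.
  have hPd := (differentiableAt_canonPeriod hq hα).hasDerivAt
  have hAd := (differentiableAt_canonArea hq hα).hasDerivAt
  have hId := hasDerivAt_canonAction hq hα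
  have hEd := hasDerivAt_canonBif hq hα hP hA
  have hA' := deriv_canonArea hq hα
  have hAeq : canonArea q α = (q + 3) / 2 * canonAction q α
    - (q + 1) * (canonPeriod q α * canonPot q α) + canonPeriod q α := rfl
  have hE : canonPeriod q α ^ q * canonArea q α ^ (-(q + 1)) * canonBif q α =
      canonPeriod q α ^ 3 / canonArea q α ^ 2 := by
    rw [canonBif, mul_mul_mul_comm, ← Real.rpow_add hP, ← Real.rpow_add hA,
      show q + (3 - q) = ((3 : ℕ) : ℝ) by push_cast; ring,
      show -(q + 1) + (q - 1) = -((2 : ℕ) : ℝ) by push_cast; ring, Real.rpow_natCast,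
      Real.rpow_neg hA.le, Real.rpow_natCast, div_eq_mul_inv]
  rw [hEd.deriv]
  have hmain : HasDerivAt (canonGap q) _ α :=
    (((((hPd.pow 3).div (hAd.pow 2) (pow_ne_zero 2 hA.ne')).mul hId).const_mul
    ((q - 1) / (2 * (q + 1)))).sub (((hPd.pow 3).div hAd hA.ne').const_mul
    (1 / (q * (q + 1))))).add (hEd.const_mul (1 / (q * (q + 1))))
  convert! hmain using 1
  simp only [Pi.pow_apply, Pi.div_apply]
  generalize canonPeriod q α ^ q * canonArea q α ^ (-(q + 1)) = G at *
  generalize canonBif q α = E at *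
  generalize oscForce q α = u at *
  generalize canonPot q α = U at *
  generalize canonAction q α = I at *
  obtain ⟨a, ha⟩ : ∃ a, deriv (canonPeriod q) α = a * canonPeriod q α :=
    ⟨_, (div_mul_cancel₀ _ hP.ne').symm⟩
  obtain ⟨b, hb⟩ : ∃ b, deriv (canonArea q) α = b * canonArea q α :=
    ⟨_, (div_mul_cancel₀ _ hA.ne').symm⟩
  rw [hb, ha] at hA'
  rw [ha, hb]
  generalize canonPeriod q α = P at *
  generalize canonArea q α = A at *
  rw [mul_div_cancel_right₀ _ hP.ne', mul_div_cancel_right₀ _ hA.ne']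
  -- With `a` and `b` the logarithmic derivatives of period and area, this is the differentiated
  -- area formula minus `a` times the area formula itself.
  have hbr : (q - 1) / (2 * (q + 1)) * (u * P + (3 * a - 2 * b) * I)
      - 1 / (q * (q + 1)) * (A * (3 * a - b))
      + 1 / (q * (q + 1)) * ((q * I + A) * ((3 - q) * a + (q - 1) * b)) = 0 := by
    field_simp
    linear_combination 2 * q * hA' - 2 * a * q * hAeq
  have e1 : (((3 : ℕ) : ℝ) * P ^ (3 - 1) * (a * P) * A ^ 2
      - P ^ 3 * (((2 : ℕ) : ℝ) * A ^ (2 - 1) * (b * A))) / (A ^ 2) ^ 2 =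
      P ^ 3 / A ^ 2 * (3 * a - 2 * b) := by
    push_cast; field_simp
  have e2 : (((3 : ℕ) : ℝ) * P ^ (3 - 1) * (a * P) * A - P ^ 3 * (b * A)) / A ^ 2 =
      P ^ 3 / A ^ 2 * (A * (3 * a - b)) := by
    push_cast; field_simp
  rw [e1, e2]
  linear_combination (-(P ^ 3 / A ^ 2)) * hbr
    - 1 / (q * (q + 1)) * (q * I + A) * ((3 - q) * a + (q - 1) * b) * hE

theorem bifE_eq_canonBif (hq : 0 < q) (hα : α ∈ Ioo (0 : ℝ) 1) : bifE q α = canonBif q α := by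
  obtain ⟨hP, hA, -⟩ := canonical_integrals hq hα
  rw [bifE, canonBif, hP, hA]

theorem deriv_bifE (hq : 0 < q) (hα : α ∈ Ioo (0 : ℝ) 1) :
    deriv (bifE q) α = deriv (canonBif q) α :=
  EventuallyEq.deriv_eq (eventually_of_mem (Ioo_mem_nhds hα.1 hα.2) fun _ hβ =>
    bifE_eq_canonBif hq hβ)

/-- The normalized gap moves against the bifurcation parameter. -/
theorem exists_deriv_canonGap (hq : 0 < q) (hα : α ∈ Ioo (0 : ℝ) 1) :
    ∃ J, 0 < J ∧ deriv (canonGap q) α = -(J * deriv (bifE q) α) := by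
  obtain ⟨-, -, hP, hA, -, -, -, hJ⟩ := canonical_integrals hq hα
  rw [deriv_bifE hq hα, (hasDerivAt_canonGap hq (Ioo_subset_Ioc_self hα) hP hA).deriv]
  -- What remains is the strict Jensen inequality `hJ`, divided by powers of the period and the
  -- area.
  refine ⟨_, mul_pos (by positivity) (sub_pos.2 ?_), rfl⟩
  rw [Real.div_rpow hA.le hP.le, Real.rpow_add_one hP.ne'] at hJ
  rw [Real.rpow_neg hA.le]
  have h1 := Real.rpow_pos_of_pos hP q
  have h2 := Real.rpow_pos_of_pos hA (q + 1)
  generalize canonPeriod q α ^ q = x at *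
  generalize canonArea q α ^ (q + 1) = y at *
  rw [← div_eq_mul_inv, div_mul_eq_mul_div, one_lt_div h2]
  have h3 : canonPeriod q α * (y / (x * canonPeriod q α)) = y / x := by field_simp
  rw [h3, div_lt_iff₀ h1] at hJ
  linarith

theorem continuousOn_canonGap (hq : 0 < q) (hα : 0 < α) : ContinuousOn (canonGap q) (Icc α 1) := by
  intro β hβ
  have hβ' : β ∈ Ioc (0 : ℝ) 1 := ⟨hα.trans_le hβ.1, hβ.2⟩
  have hpos : 0 < canonPeriod q β ∧ 0 < canonArea q β := by
    rcases hβ.2.lt_or_eq with h | rfl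
    · obtain ⟨-, -, hP, hA, -⟩ := canonical_integrals hq ⟨hβ'.1, h⟩
      exact ⟨hP, hA⟩
    · rw [canonPeriod_one hq, canonArea_one hq]
      exact ⟨Real.two_pi_pos, Real.two_pi_pos⟩
  exact (hasDerivAt_canonGap hq hβ' hpos.1 hpos.2).continuousAt.continuousWithinAt

/-- At `α = 1` the orbit degenerates to rest and the gap is zero. On `(α, 1)` the gap decreases as
long as `E` increases. -/
theorem canonGap_pos (hq : 0 < q) (hα : α ∈ Ioo (0 : ℝ) 1)
    (hE : ∀ β ∈ Ioo α 1, 0 < deriv (bifE q) β) : 0 < canonGap q α := by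
  rw [← canonGap_one hq]
  refine strictAntiOn_of_deriv_neg (convex_Icc α 1) (continuousOn_canonGap hq hα.1)
    (fun β hβ => ?_) (left_mem_Icc.2 hα.2.le) (right_mem_Icc.2 hα.2.le) hα.2
  rw [interior_Icc] at hβ
  obtain ⟨J, hJ, h⟩ := exists_deriv_canonGap hq ⟨hα.1.trans hβ.1, hβ.2⟩
  rw [h]
  exact neg_neg_of_pos (mul_pos hJ (hE β hβ))

theorem canonGap_neg (hq : 0 < q) (hα : α ∈ Ioo (0 : ℝ) 1)
    (hE : ∀ β ∈ Ioo α 1, deriv (bifE q) β < 0) : canonGap q α < 0 := by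
  rw [← canonGap_one hq]
  refine strictMonoOn_of_deriv_pos (convex_Icc α 1) (continuousOn_canonGap hq hα.1)
    (fun β hβ => ?_) (left_mem_Icc.2 hα.2.le) (right_mem_Icc.2 hα.2.le) hα.2
  rw [interior_Icc] at hβ
  obtain ⟨J, hJ, h⟩ := exists_deriv_canonGap hq ⟨hα.1.trans hβ.1, hβ.2⟩
  rw [h]
  exact neg_pos.2 (mul_neg_of_pos_of_neg hJ (hE β hβ))

end

/-! ### Transfer of the gap from the canonical solution to the steady state -/

theorem isLeast_positivePeriods_rescale {h : ℝ → ℝ} {X μ l : ℝ} (hμ : μ ≠ 0) (hl : 0 < l)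
    (hX : IsLeast (positivePeriods h) X) :
    IsLeast (positivePeriods fun x => μ * h (l * x)) (X / l) := by
  refine ⟨⟨div_pos hX.1.1 hl, fun x => ?_⟩, fun T hT => ?_⟩
  · simp only
    rw [mul_add, mul_div_cancel₀ _ hl.ne', hX.1.2]
  · rw [div_le_iff₀ hl]
    refine hX.2 ⟨mul_pos hT.1 hl, fun x => ?_⟩
    have := hT.2 (x / l)
    simp only at this
    rw [mul_add, mul_div_cancel₀ _ hl.ne', mul_comm l T] at this
    exact mul_left_cancel₀ hμ this

theorem canonGap_eq {q α : ℝ} (hq : 0 < q) (hP : 0 < canonPeriod q α) (hA : 0 < canonArea q α) :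
    canonGap q α = canonPeriod q α ^ 3 / canonArea q α ^ 2 * (1 / 2 * canonAction q α
      - 1 / (q * (q + 1)) * ((q * canonAction q α + canonArea q α)
        - canonPeriod q α * (canonArea q α / canonPeriod q α) ^ (q + 1))) := by
  have hE : canonBif q α = canonPeriod q α ^ 3 / canonArea q α ^ 2
      * (canonPeriod q α * (canonArea q α / canonPeriod q α) ^ (q + 1)) := by
    rw [canonBif, Real.div_rpow hA.le hP.le, Real.rpow_add_one hP.ne', Real.rpow_add_one hA.ne',
      Real.rpow_sub hP, Real.rpow_sub_one hA.ne',
      show (3 : ℝ) = ((3 : ℕ) : ℝ) by norm_num, Real.rpow_natCast]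
    have h1 := Real.rpow_pos_of_pos hP q
    generalize canonPeriod q α ^ q = x at *
    generalize canonArea q α ^ q = y at *
    field_simp
  rw [canonGap, hE]
  field_simp
  ring

/-- The energy gap of a steady state is a positive multiple of the normalized gap of the canonical
solution it rescales to. -/
theorem exists_filmEnergy_sub_eq {n m q B X α x₀ : ℝ} {H h : ℝ → ℝ} (hB : 0 < B)
    (hq : q = m - n + 1) (hq0 : 0 < q)
    (hH : IsEnergyPotential (fun y => y ^ n) (fun y => B * y ^ m) H)
    (hss : IsPositivePeriodicSteadyState (fun y => y ^ n) (fun y => B * y ^ m) X h)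
    (hα : α ∈ Ioo (0 : ℝ) 1) (hres : RescalesTo q B (fun x => h (x + x₀)) (kCanon q α)) :
    ∃ c, 0 < c ∧
      filmEnergy H X h - filmEnergy H X (fun _ => meanOver X h) = c * canonGap q α := by
  obtain ⟨-, D, hD, -, hk⟩ | ⟨h0, -⟩ := hres
  swap
  · exact absurd h0 hq0.ne'
  obtain ⟨C, ho'⟩ := hss.exists_isOscillation hH
  have hX := hss.leastPeriod
  have hX0 : 0 < X := hX.1.1
  obtain ⟨K, hK⟩ := hH.exists_deriv_eq hq
  set μ := (B / D) ^ (1 / q) with hμdef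
  set l := (D / B) ^ (1 / (2 * q)) / D ^ (1 / 2 : ℝ) with hldef
  have hμ : 0 < μ := Real.rpow_pos_of_pos (div_pos hB hD) _
  have hl : 0 < l := div_pos (Real.rpow_pos_of_pos (div_pos hD hB) _) (Real.rpow_pos_of_pos hD _)
  have hscale : μ * l ^ 2 = 1 / D := rescale_factor_mul_sq hq0.ne' hB hD
  have hμq : μ ^ q = B / D := rescale_factor_rpow hq0.ne' hB hD
  set g : ℝ → ℝ := fun x => h (x + x₀) with hg
  set p : ℝ → ℝ := fun x => deriv h (x + x₀) with hp
  have ho : IsOscillation _ g p := ho'.shift x₀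
  have hgX : IsLeast (positivePeriods g) X := by rw [hg, positivePeriods_shift]; exact hX
  have hkeq : kCanon q α = fun x => μ * g (l * x) := funext fun x => by
    rw [hk x]; congr 2; rw [hldef]; ring
  obtain ⟨-, -, hP0, hA0, hPleast, hI, hM, -⟩ := canonical_integrals hq0 hα
  have hA : ∫ x in (0 : ℝ)..canonPeriod q α, kCanon q α x = canonArea q α := by
    obtain ⟨e1, e2, -⟩ := canonical_integrals hq0 hα
    rw [← e2, areaMap, e1]
  have hP : canonPeriod q α = X / l := by
    rw [hkeq] at hPleast
    exact hPleast.unique (isLeast_positivePeriods_rescale hμ.ne' hl hgX)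
  have hkd : ∀ x, deriv (kCanon q α) x = μ * l * p (l * x) := fun x => by
    have h1 := ((ho.hasDerivAt (l * x)).comp x ((hasDerivAt_id x).const_mul l)).const_mul μ
    have h2 : HasDerivAt (kCanon q α) (μ * (p (l * x) * (l * 1))) x := by rw [hkeq]; exact h1
    rw [h2.deriv]; ring
  have hlP : l * (X / l) = X := mul_div_cancel₀ _ hl.ne'
  set M := meanOver X h with hMdef
  have hM0 : 0 < M := meanOver_pos hX0 ho'.continuous ho'.pos
  have hmean : ∫ x in (0 : ℝ)..X, g x = X * M := integral_shift_eq_mul_meanOver hX0 hX.1.2 x₀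
  have hgc := ho.continuous
  have hpc := ho.continuous_vel
  have hgq : Continuous fun x => g x ^ (q + 1) := ho.continuous_comp (continuousOn_rpow_Ioi _)
  have sI : canonAction q α = μ ^ 2 * l * ∫ x in (0 : ℝ)..X, p x ^ 2 := by
    rw [← hI, hP]
    simp only [hkd, mul_pow]
    rw [intervalIntegral.integral_const_mul,
      intervalIntegral.integral_comp_mul_left (fun x => p x ^ 2) hl.ne', hlP, mul_zero, smul_eq_mul]
    field_simp
  have sA : canonArea q α = μ / l * (X * M) := by
    rw [← hA, hP, hkeq, intervalIntegral.integral_const_mul,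
      intervalIntegral.integral_comp_mul_left g hl.ne', hlP, mul_zero, hmean, smul_eq_mul]
    ring
  have sM : q * canonAction q α + canonArea q α =
      μ * (B / D) / l * ∫ x in (0 : ℝ)..X, g x ^ (q + 1) := by
    rw [← hM, hP, hkeq]
    simp only [fun x => Real.mul_rpow (z := q + 1) hμ.le (ho.pos (l * x)).le]
    rw [intervalIntegral.integral_const_mul,
      intervalIntegral.integral_comp_mul_left (fun x => g x ^ (q + 1)) hl.ne', hlP, mul_zero,
      smul_eq_mul, Real.rpow_add_one hμ.ne', hμq]
    ring
  have sc : canonArea q α / canonPeriod q α = μ * M := by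
    rw [sA, hP]; field_simp
  have hgap : filmEnergy H X h - filmEnergy H X (fun _ => M) =
      1 / 2 * (∫ x in (0 : ℝ)..X, p x ^ 2) - B / (q * (q + 1)) *
        ((∫ x in (0 : ℝ)..X, g x ^ (q + 1)) - X * M ^ (q + 1)) := by
    rw [filmEnergy_sub_filmEnergy_mean hH ho' hX0 hX.1.2 K x₀]
    -- Modulo affine terms, which do not affect the excess over the mean, `H` is `B` times the
    -- canonical potential.
    have hpot : ∀ y, 0 < y → H y - K * y = B * canonPot q y + (H 1 - K) := by
      intro y hy
      have hd : ∀ y ∈ Ioi (0 : ℝ), HasDerivAt (fun y => H y - K * y - B * canonPot q y) 0 y :=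
        fun y hy => by
          have := ((hH y hy).1.hasDerivAt.fun_sub ((hasDerivAt_id y).const_mul K)).fun_sub
            ((hasDerivAt_canonPot hq0 hy).const_mul B)
          rw [hK y hy] at this
          simpa using this
      have := isOpen_Ioi.is_const_of_deriv_eq_zero isPreconnected_Ioi
        (fun y hy => (hd y hy).differentiableAt.differentiableWithinAt)
        (fun y hy => (hd y hy).deriv) (mem_Ioi.2 hy) (mem_Ioi.2 one_pos)
      simp only [canonPot_one hq0] at this
      linarith
    have hpt : ∀ x, 1 / 2 * deriv h (x + x₀) ^ 2 - ((H (h (x + x₀)) - K * h (x + x₀))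
        - (H M - K * M)) = 1 / 2 * p x ^ 2 - B / (q * (q + 1)) * (g x ^ (q + 1) - M ^ (q + 1))
        + B / q * (g x - M) := fun x => by
      rw [hpot _ (ho'.pos _), hpot _ hM0, canonPot, canonPot]
      simp only [hp, hg]
      field_simp
      ring
    simp only [← hMdef, hpt]
    have c1 : Continuous fun x => 1 / 2 * p x ^ 2 := by fun_prop
    have c2 : Continuous fun x => B / (q * (q + 1)) * (g x ^ (q + 1) - M ^ (q + 1)) :=
      continuous_const.mul (hgq.sub continuous_const)
    have c3 : Continuous fun x => B / q * (g x - M) := by fun_prop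
    have c4 : Continuous fun x => 1 / 2 * p x ^ 2
        - B / (q * (q + 1)) * (g x ^ (q + 1) - M ^ (q + 1)) := c1.sub c2
    rw [intervalIntegral.integral_add (c4.intervalIntegrable _ _)
      (c3.intervalIntegrable _ _), intervalIntegral.integral_sub (c1.intervalIntegrable _ _)
      (c2.intervalIntegrable _ _)]
    simp only [intervalIntegral.integral_const_mul]
    rw [intervalIntegral.integral_sub (hgq.intervalIntegrable _ _) (by simp),
      intervalIntegral.integral_sub (hgc.intervalIntegrable _ _) (by simp), hmean]
    simp
  have hDl : D * μ * l ^ 2 = 1 := by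
    rw [mul_assoc, hscale]; field_simp
  -- Rescaling multiplies the kinetic part by `μ² l`, and by `D μ l² = 1` the potential part by the
  -- same factor; `P³/A²` is the normalization built into `canonGap`.
  refine ⟨1 / (canonPeriod q α ^ 3 / canonArea q α ^ 2 * (μ ^ 2 * l)), by positivity, ?_⟩
  rw [canonGap_eq hq0 hP0 hA0, hgap, sM, sI, sc, Real.mul_rpow hμ.le hM0.le,
    Real.rpow_add_one hμ.ne', hμq]
  have hP3 : canonPeriod q α ^ 3 / canonArea q α ^ 2 ≠ 0 := by positivity
  generalize canonPeriod q α ^ 3 / canonArea q α ^ 2 = Z at hP3 ⊢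
  rw [hP]
  generalize (∫ x in (0 : ℝ)..X, g x ^ (q + 1)) = R
  generalize (∫ x in (0 : ℝ)..X, p x ^ 2) = T
  generalize M ^ (q + 1) = N
  have hDe : D = 1 / (μ * l ^ 2) := by
    field_simp
    linarith
  rw [hDe]
  field_simp

theorem mainTheorem1 (n m q B X : ℝ) (hB : 0 < B) (hq : q = m - n + 1)
    (H : ℝ → ℝ) (hH : IsEnergyPotential (fun y => y ^ n) (fun y => B * y ^ m) H)
    (h : ℝ → ℝ)
    (hss : IsPositivePeriodicSteadyState (fun y => y ^ n) (fun y => B * y ^ m) X h) :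
    ((2 ≤ q ∨ q < 1) →
      filmEnergy H X (fun _ => meanOver X h) < filmEnergy H X h) ∧
    (q = 1 →
      filmEnergy H X h = filmEnergy H X (fun _ => meanOver X h)) ∧
    (∀ x₀ : ℝ, (∀ x, h x₀ ≤ h x) →
      (∃ α ∈ Set.Ioo (0 : ℝ) 1, RescalesTo q B (fun x => h (x + x₀)) (kCanon q α)) ∧
      (∀ α ∈ Set.Ioo (0 : ℝ) 1, RescalesTo q B (fun x => h (x + x₀)) (kCanon q α) →
        ((1 < q ∧ q < 2 ∧ ∀ β ∈ Set.Ioo α 1, 0 < deriv (bifE q) β) →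
          filmEnergy H X (fun _ => meanOver X h) < filmEnergy H X h) ∧
        ((1 < q ∧ q < 2 ∧ ∀ β ∈ Set.Ioo α 1, deriv (bifE q) β < 0) →
          filmEnergy H X h < filmEnergy H X (fun _ => meanOver X h)))) := by
  refine ⟨filmEnergy_mean_lt hB hq hH hss, ?_, fun x₀ hx₀ =>
    ⟨exists_rescalesTo_kCanon hB hq hH hss hx₀, fun α hα hres => ⟨?_, ?_⟩⟩⟩
  · rintro rfl
    exact filmEnergy_eq_filmEnergy_mean hq hH hss
  · rintro ⟨h1, -, hE⟩
    obtain ⟨c, hc, hgap⟩ := exists_filmEnergy_sub_eq hB hq (by linarith) hH hss hα hres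
    rw [← sub_pos, hgap]
    exact mul_pos hc (canonGap_pos (by linarith) hα hE)
  · rintro ⟨h1, -, hE⟩
    obtain ⟨c, hc, hgap⟩ := exists_filmEnergy_sub_eq hB hq (by linarith) hH hss hα hres
    rw [← sub_neg, hgap]
    exact mul_neg_of_pos_of_neg hc (canonGap_neg (by linarith) hα hE)
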